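/- Let $K$ be an algebraically closed field and let $Y$ be a cocommutative bialgebra over $K$. Let $\mathcal C$ be the category of cocommutative $K$-bialgebras and bialgebra morphisms; it is pointed, with zero morphism $X\to X'$, $x\mapsto\varepsilon(x)\cdot 1$. A split extension over an object $B$ of $\mathcal C$ consists of morphisms $k\colon A\to X$, $f\colon X\to B$, $s\colon B\to X$ in $\mathcal C$ such that $f\circ s=1_B$ and $k$ is a kernel of $f$ in $\mathcal C$. It is strong (one also says that it admits a join decomposition) if every monomorphism $m\colon M\to X$ in $\mathcal C$ through which both $k$ and $s$ factor is an isomorphism. It is stably strong if for every morphism $g\colon W\to B$ in $\mathcal C$ its pullback along $g$ is strong; this pullback is the split extension over $W$ formed by the projection $W\times_B X\to W$, its section $\langle 1_W,s\circ g\rangle$ and a kernel of the projection. The object $B$ is protomodular if all split extensions over $B$ are stably strong. Then the following conditions are equivalent: (i) $Y$ is a Hopf algebra (that is, $Y$ has an antipode); (ii) in $\mathcal C$, all split extensions over $Y$ admit a join decomposition, i.e. are strong; (iii) $Y$ is a protomodular object of $\mathcal C$, i.e. all split extensions over $Y$ are stably strong. -/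

import Mathlib

open CategoryTheory CategoryTheory.Limits

universe v u

section General

variable {C : Type u} [Category.{v} C]

/-- Two arrows with the same codomain `X` are jointly extremally epimorphic when they cannot both
factor through one and the same proper subobject of `X`. -/
def JointlyExtremallyEpi {A X B : C} (k : A ⟶ X) (s : B ⟶ X) : Prop :=
  ∀ ⦃M : C⦄ (m : M ⟶ X) [Mono m] (a : A ⟶ M) (b : B ⟶ M), a ≫ m = k → b ≫ m = s → IsIso m

/-- A split extension over `Y`: a morphism `f : X ⟶ Y` with a section `s` and a kernel `k`. -/
structure SplitExtension [HasZeroMorphisms C] (Y : C) where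
  /-- the domain of the kernel -/
  ker : C
  /-- the middle object -/
  mid : C
  /-- the kernel of `f` -/
  k : ker ⟶ mid
  /-- the split epimorphism -/
  f : mid ⟶ Y
  /-- the section of `f` -/
  s : Y ⟶ mid
  section_comp : s ≫ f = 𝟙 Y
  kernel_comp : k ≫ f = 0
  /-- `k` is a kernel of `f` -/
  isKernel : IsLimit (KernelFork.ofι k kernel_comp)

namespace SplitExtension

variable [HasZeroMorphisms C]

/-- A split extension is strong, that is, admits a join decomposition, when the kernel and the
section are jointly extremally epimorphic. -/
def IsStrong {Y : C} (E : SplitExtension Y) : Prop :=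
  JointlyExtremallyEpi E.k E.s

/-- `E'` is a pullback of the split extension `E` along `g`, with projection `q` on the middle
objects: the split epimorphism of `E'` is the pullback of that of `E`, its section is the one
induced by the section of `E` and the identity of `W`. The kernel part of `E'` is any kernel. -/
structure IsPullbackAlong {W Y : C} (E' : SplitExtension W) (E : SplitExtension Y) (g : W ⟶ Y)
    (q : E'.mid ⟶ E.mid) : Prop where
  isPullback : IsPullback q E'.f E.f g
  section_comp_proj : E'.s ≫ q = g ≫ E.s

/-- A split extension is stably strong when all of its pullbacks, along any morphism, are
strong. -/
def IsStablyStrong {Y : C} (E : SplitExtension Y) : Prop :=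
  ∀ ⦃W : C⦄ (g : W ⟶ Y) (E' : SplitExtension W) (q : E'.mid ⟶ E.mid),
    E'.IsPullbackAlong E g q → E'.IsStrong

end SplitExtension

/-- An object is protomodular when all split extensions over it are stably strong. -/
def IsProtomodularObject [HasZeroMorphisms C] (Y : C) : Prop :=
  ∀ E : SplitExtension Y, E.IsStablyStrong

end General

section Bialgebras

/-- The category of cocommutative bialgebras over `K`, as a full subcategory of the category of
bialgebras. -/
abbrev CocommBialgCat (K : Type u) [CommRing K] :=
  ObjectProperty.FullSubcategory
    (fun B : BialgCat.{u} K => Coalgebra.IsCocomm K B)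

namespace CocommBialgCat

variable (K : Type u) [CommRing K]

/-- A cocommutative bialgebra as an object of the category of cocommutative bialgebras. -/
abbrev of (B : Type u) [Ring B] [Bialgebra K B] [h : Coalgebra.IsCocomm K B] :
    CocommBialgCat K :=
  ⟨BialgCat.of K B, h⟩

/-- The category is pointed: the zero morphism is `x ↦ ε(x) 1`. -/
noncomputable instance : HasZeroMorphisms (CocommBialgCat K) where
  zero X Y := ⟨ObjectProperty.homMk
    ⟨(Bialgebra.unitBialgHom K Y.obj).comp (Bialgebra.counitBialgHom K X.obj)⟩⟩
  comp_zero {X Y} f Z := by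
    apply ObjectProperty.hom_ext
    apply BialgCat.hom_ext
    exact congrArg (Bialgebra.unitBialgHom K Z.obj).comp (Subsingleton.elim
      ((Bialgebra.counitBialgHom K Y.obj).comp f.hom.toBialgHom)
      (Bialgebra.counitBialgHom K X.obj))
  zero_comp X {Y Z} f := by
    apply ObjectProperty.hom_ext
    apply BialgCat.hom_ext
    exact congrArg (fun t => BialgHom.comp t (Bialgebra.counitBialgHom K X.obj))
      (BialgHom.ext_of_ring
        (f := f.hom.toBialgHom.comp (Bialgebra.unitBialgHom K Y.obj))
        (g := Bialgebra.unitBialgHom K Z.obj) (by simp))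

end CocommBialgCat

/-- A bialgebra is a Hopf algebra when it has an antipode, that is, when its bialgebra structure
underlies a Hopf algebra structure. -/
def IsHopfAlgebra (K : Type u) (Y : Type v) [CommRing K] [Ring Y] [B : Bialgebra K Y] : Prop :=
  ∃ H : HopfAlgebra K Y, H.toBialgebra = B

end Bialgebras

/-!
If `Y` is a Hopf algebra with antipode `S` and `f : X ⟶ Y` is split by `s`, then
`π : x ↦ x₁ · s (S (f x₂))` takes values in the kernel of `f`, and `x = π(x₁) · s (f x₂)`: every
element is a sum of products of elements that come from the kernel and from the section. By
cocommutativity `π` is a morphism of coalgebras, and the computation can be carried out with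
coalgebra morphisms `T → X` in place of elements; they form a monoid under convolution, and
the argument becomes the one for groups. A pullback of `f` has the same kernel as `f`, so that `π`
lifts to it and gives the same decomposition there, although `W` need not have an antipode
(`CocommBialgCat.isStablyStrong_of_antipode`). Monomorphisms and pullback projections of bialgebras
can be tested on coalgebra morphisms because equalizers of bialgebras are computed as for
coalgebras (`SubBialgebra.equalizer`).

Conversely, assume that all split extensions over `Y` are strong. Over an algebraically closed
field, a cocommutative bialgebra has an antipode as soon as its group-like elements are invertible
(`isHopfAlgebra_of_isUnit`): the elements killed by a finite product of vanishing ideals of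
group-like elements, taken in the dual algebra, exhaust the coalgebra, and a convolution inverse of
the identity is built by adding one factor at a time. So it is enough to invert a group-like
element `g`.

The pattern is that of monoids: for an element `g` of a monoid `Y`, adjoin to `Y` a formal symbol
`t` over `g` with `t c t = t c g`; the result is the set `Y ⊔ (Y × Y)`, whose elements are `y` and
`a t b`, and if `t` is a product `y (a t b) z` with `a g b = 1`, then `y a = 1 = b z` and `g` is
invertible. The linear version of this monoid is `GroupLike.Insertion`, with underlying coalgebra
`Y ⊕ (Y ⊗ Y)`. Strongness says that it is generated as an algebra by the kernel and by `Y`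
(`CocommBialgCat.sup_eq_top_of_isStrong`), and hence `t` is a value of the coalgebra morphism
`y ⊗ α ⊗ z ↦ y α z`, with `α` in the kernel (`GroupLike.Insertion.exists_sandwich_eq`).

A value is only a linear combination of products. To reach a single product, `t` is lifted to a
group-like element of the source, which is then a pure tensor of group-like elements. Such lifts
exist along every morphism of cocommutative coalgebras over an algebraically closed field
(`DualAlgebra.exists_isGroupLikeElem_map_eq`): group-like elements are the characters of the dual
algebra that factor through a finite-dimensional quotient, and characters extend along finite ring
extensions by lying over and the Nullstellensatz in dimension zero.
-/

open scoped TensorProduct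
open Coalgebra

/-! ### Sub-bialgebras -/

section SubBialgebra

/-- A sub-bialgebra of `H`: a subalgebra `S` whose comultiplication takes values in the image of
`S ⊗ S` in `H ⊗ H`. -/
structure SubBialgebra (K H : Type*) [Field K] [Ring H] [Bialgebra K H] extends
    Subalgebra K H where
  comul_mem' : ∀ x ∈ toSubalgebra,
    comul (R := K) x ∈ (Algebra.TensorProduct.map toSubalgebra.val toSubalgebra.val).range

namespace SubBialgebra

variable {K H P T : Type*} [Field K] [Ring H] [Bialgebra K H] [Ring P] [Bialgebra K P]
  [AddCommGroup T] [Module K T] [Coalgebra K T] (S : SubBialgebra K H)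

/-- The underlying type of a sub-bialgebra. -/
abbrev Carrier : Type _ := S.toSubalgebra

lemma map_val_injective :
    Function.Injective (Algebra.TensorProduct.map S.toSubalgebra.val S.toSubalgebra.val) :=
  TensorProduct.map_injective_of_flat_flat
    S.toSubalgebra.val.toLinearMap S.toSubalgebra.val.toLinearMap
    Subtype.val_injective Subtype.val_injective

lemma map_val_val_injective :
    Function.Injective (Algebra.TensorProduct.map S.toSubalgebra.val
      (Algebra.TensorProduct.map S.toSubalgebra.val S.toSubalgebra.val)) :=
  TensorProduct.map_injective_of_flat_flat S.toSubalgebra.val.toLinearMap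
    (Algebra.TensorProduct.map S.toSubalgebra.val S.toSubalgebra.val).toLinearMap
    Subtype.val_injective S.map_val_injective

/-- The comultiplication of `H`, restricted to a sub-bialgebra. -/
noncomputable def comulRestrict : S.Carrier →ₐ[K] S.Carrier ⊗[K] S.Carrier :=
  (AlgEquiv.ofInjective _ S.map_val_injective).symm.toAlgHom.comp
    (((Bialgebra.comulAlgHom K H).comp S.toSubalgebra.val).codRestrict _
      fun x => S.comul_mem' x x.2)

lemma map_val_comulRestrict (x : S.Carrier) :
    Algebra.TensorProduct.map S.toSubalgebra.val S.toSubalgebra.val (S.comulRestrict x) =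
      comul (R := K) (x : H) :=
  congrArg Subtype.val ((AlgEquiv.ofInjective _ S.map_val_injective).apply_symm_apply
    ⟨comul (R := K) (x : H), S.comul_mem' x x.2⟩)

noncomputable instance : Bialgebra K S.Carrier :=
  Bialgebra.ofAlgHom S.comulRestrict ((Bialgebra.counitAlgHom K H).comp S.toSubalgebra.val)
    (by
      ext x
      apply S.map_val_val_injective
      have h₁ (z : S.Carrier ⊗[K] S.Carrier) :
          Algebra.TensorProduct.map S.toSubalgebra.val
            (Algebra.TensorProduct.map S.toSubalgebra.val S.toSubalgebra.val)
            (Algebra.TensorProduct.assoc K K K S.Carrier S.Carrier S.Carrier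
              (Algebra.TensorProduct.map S.comulRestrict (.id K S.Carrier) z)) =
          TensorProduct.assoc K H H H ((comul (R := K)).rTensor H
            (Algebra.TensorProduct.map S.toSubalgebra.val S.toSubalgebra.val z)) := by
        induction z with
        | zero => simp
        | add z w hz hw => simp only [map_add, hz, hw]
        | tmul a b =>
          simp only [Algebra.TensorProduct.map_tmul, AlgHom.coe_id, id_eq,
            LinearMap.rTensor_tmul, Subalgebra.coe_val, ← S.map_val_comulRestrict a]
          induction S.comulRestrict a with
          | zero => simp
          | add z w hz hw => simp only [map_add, TensorProduct.add_tmul, hz, hw]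
          | tmul c d => simp
      have h₂ (z : S.Carrier ⊗[K] S.Carrier) :
          Algebra.TensorProduct.map S.toSubalgebra.val
            (Algebra.TensorProduct.map S.toSubalgebra.val S.toSubalgebra.val)
            (Algebra.TensorProduct.map (.id K S.Carrier) S.comulRestrict z) =
          (comul (R := K)).lTensor H
            (Algebra.TensorProduct.map S.toSubalgebra.val S.toSubalgebra.val z) := by
        induction z with
        | zero => simp
        | add z w hz hw => simp only [map_add, hz, hw]
        | tmul a b => simp [S.map_val_comulRestrict b]
      exact (h₁ _).trans (Eq.trans (by simp [S.map_val_comulRestrict]) (h₂ _).symm))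
    (by
      ext x
      apply (Algebra.TensorProduct.lid K S.Carrier).injective
      apply Subtype.val_injective
      have h (z : S.Carrier ⊗[K] S.Carrier) :
          (Algebra.TensorProduct.lid K S.Carrier (Algebra.TensorProduct.map
            ((Bialgebra.counitAlgHom K H).comp S.toSubalgebra.val) (.id K S.Carrier) z) : H) =
          TensorProduct.lid K H ((counit (R := K)).rTensor H
            (Algebra.TensorProduct.map S.toSubalgebra.val S.toSubalgebra.val z)) := by
        induction z with
        | zero => simp
        | add z w hz hw => simp only [map_add, Subalgebra.coe_add, hz, hw]
        | tmul a b => simp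
      exact (h _).trans (by simp [S.map_val_comulRestrict]))
    (by
      ext x
      apply (Algebra.TensorProduct.rid K K S.Carrier).injective
      apply Subtype.val_injective
      have h (z : S.Carrier ⊗[K] S.Carrier) :
          (Algebra.TensorProduct.rid K K S.Carrier (Algebra.TensorProduct.map
            (.id K S.Carrier) ((Bialgebra.counitAlgHom K H).comp S.toSubalgebra.val) z) : H) =
          TensorProduct.rid K H ((counit (R := K)).lTensor H
            (Algebra.TensorProduct.map S.toSubalgebra.val S.toSubalgebra.val z)) := by
        induction z with
        | zero => simp
        | add z w hz hw => simp only [map_add, Subalgebra.coe_add, hz, hw]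
        | tmul a b => simp
      exact (h _).trans (by simp [S.map_val_comulRestrict]))

/-- The inclusion of a sub-bialgebra. -/
noncomputable def incl : S.Carrier →ₐc[K] H :=
  .ofAlgHom S.toSubalgebra.val rfl (AlgHom.ext fun x => S.map_val_comulRestrict x)

@[simp] lemma incl_apply (x : S.Carrier) : S.incl x = x := rfl

lemma map_incl_injective : Function.Injective (TensorProduct.map
    (S.incl : S.Carrier →ₗ[K] H) (S.incl : S.Carrier →ₗ[K] H)) := S.map_val_injective

lemma map_incl_comul (x : S.Carrier) :
    TensorProduct.map (S.incl : S.Carrier →ₗ[K] H) (S.incl : S.Carrier →ₗ[K] H)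
      (comul (R := K) x) = comul (R := K) (x : H) :=
  S.map_val_comulRestrict x

instance [IsCocomm K H] : IsCocomm K S.Carrier where
  comm_comp_comul := by
    ext x
    apply S.map_incl_injective
    rw [LinearMap.comp_apply, LinearEquiv.coe_coe, TensorProduct.map_comm, S.map_incl_comul,
      comm_comul]

/-- A coalgebra morphism with values in a sub-bialgebra, corestricted to it. -/
def coalgCodRestrict (c : T →ₗc[K] H) (hc : ∀ t, c t ∈ S.toSubalgebra) : T →ₗc[K] S.Carrier where
  toFun t := ⟨c t, hc t⟩
  map_add' x y := Subtype.ext (map_add c x y)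
  map_smul' r x := Subtype.ext (map_smul c r x)
  counit_comp := LinearMap.ext fun t => CoalgHomClass.counit_comp_apply c t
  map_comp_comul := by
    ext t
    apply S.map_incl_injective
    rw [LinearMap.comp_apply, ← LinearMap.comp_apply, ← TensorProduct.map_comp]
    exact (CoalgHomClass.map_comp_comul_apply c t).trans (S.map_incl_comul ⟨c t, hc t⟩).symm

/-- A bialgebra morphism with values in a sub-bialgebra, corestricted to it. -/
def codRestrict (c : P →ₐc[K] H) (hc : ∀ t, c t ∈ S.toSubalgebra) : P →ₐc[K] S.Carrier where
  __ := S.coalgCodRestrict (c : P →ₗc[K] H) hc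
  map_one' := Subtype.ext (map_one c)
  map_mul' x y := Subtype.ext (map_mul c x y)

end SubBialgebra

end SubBialgebra

/-! ### Equalizers of cocommutative bialgebras -/

section Equalizer

open LinearMap in
/-- A tensor lying in `V ⊗ H` and in `H ⊗ V` lies in `V ⊗ V`. -/
lemma Submodule.mem_range_map_subtype {K H : Type*} [Field K] [AddCommGroup H] [Module K H]
    (V : Submodule K H) {z : H ⊗[K] H} (h₁ : z ∈ range (rTensor H V.subtype))
    (h₂ : z ∈ range (lTensor H V.subtype)) :
    z ∈ range (TensorProduct.map V.subtype V.subtype) := by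
  obtain ⟨π, hπ⟩ := V.subtype.exists_leftInverse_of_injective V.ker_subtype
  -- `e` is a projection of `H` onto `V`; applied to either leg, it fixes `z`.
  set e := V.subtype ∘ₗ π with he
  have hee : e ∘ₗ V.subtype = V.subtype := by rw [he, comp_assoc, hπ, comp_id]
  have e₁ : rTensor H e z = z := by
    obtain ⟨w, rfl⟩ := h₁
    rw [← LinearMap.comp_apply, ← rTensor_comp, hee]
  have e₂ : lTensor H e z = z := by
    obtain ⟨w, rfl⟩ := h₂
    rw [← LinearMap.comp_apply, ← lTensor_comp, hee]
  refine ⟨TensorProduct.map π π z, ?_⟩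
  rw [← LinearMap.comp_apply, ← TensorProduct.map_comp, ← he]
  conv_rhs => rw [← e₁, ← e₂]
  rw [← LinearMap.comp_apply, rTensor_comp_lTensor]

namespace SubBialgebra

variable {K H P T : Type*} [Field K] [Ring H] [Bialgebra K H] [IsCocomm K H]
  [Ring P] [Bialgebra K P] [AddCommGroup T] [Module K T] [Coalgebra K T]

/-- The equalizer of two bialgebra morphisms `u` and `v` on a cocommutative bialgebra: the
elements `h` with `h₁ ⊗ u(h₂) = h₁ ⊗ v(h₂)`. It is smaller than the set-theoretic equalizer of `u`
and `v`, which need not be a subcoalgebra. -/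
noncomputable def equalizer (u v : H →ₐc[K] P) : SubBialgebra K H where
  toSubalgebra := AlgHom.equalizer
    ((Algebra.TensorProduct.map (.id K H) (u : H →ₐ[K] P)).comp (Bialgebra.comulAlgHom K H))
    ((Algebra.TensorProduct.map (.id K H) (v : H →ₐ[K] P)).comp (Bialgebra.comulAlgHom K H))
  comul_mem' x hx := by
    set S := AlgHom.equalizer
      ((Algebra.TensorProduct.map (.id K H) (u : H →ₐ[K] P)).comp (Bialgebra.comulAlgHom K H))
      ((Algebra.TensorProduct.map (.id K H) (v : H →ₐ[K] P)).comp (Bialgebra.comulAlgHom K H))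
    let w : H →ₗ[K] P := (u : H →ₗ[K] P) - (v : H →ₗ[K] P)
    let φ : H →ₗ[K] H ⊗[K] P := w.lTensor H ∘ₗ comul
    have hS (y : H) : y ∈ S ↔ φ y = 0 := by
      simp only [φ, w, LinearMap.lTensor_sub, LinearMap.sub_comp, LinearMap.sub_apply, sub_eq_zero]
      rfl
    have hker : Subalgebra.toSubmodule S = LinearMap.ker φ := by
      ext y; exact hS y
    have hl : comul (R := K) x ∈
        LinearMap.range ((Subalgebra.toSubmodule S).subtype.lTensor H) := by
      have hex : Function.Exact (Subalgebra.toSubmodule S).subtype φ := by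
        intro y; rw [← hS y]; simp
      refine (Module.Flat.lTensor_exact H hex _).mp ?_
      have : φ.lTensor H ∘ₗ comul =
          (TensorProduct.assoc K H H P).toLinearMap ∘ₗ (comul (R := K)).rTensor P ∘ₗ φ := by
        simp only [φ, LinearMap.lTensor_comp]
        rw [LinearMap.comp_assoc, ← coassoc]
        ext y
        simp only [LinearMap.comp_apply, LinearEquiv.coe_coe]
        induction comul (R := K) y with
        | zero => simp
        | add z z' hz hz' => simp only [map_add, hz, hz']
        | tmul a b =>
          simp only [LinearMap.rTensor_tmul, LinearMap.lTensor_tmul]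
          induction comul (R := K) a with
          | zero => simp
          | add z z' hz hz' => simp only [map_add, TensorProduct.add_tmul, hz, hz']
          | tmul c d => simp
      rw [← LinearMap.comp_apply, this, LinearMap.comp_apply, LinearMap.comp_apply,
        (hS x).mp hx, map_zero, map_zero]
    have hr : comul (R := K) x ∈
        LinearMap.range ((Subalgebra.toSubmodule S).subtype.rTensor H) := by
      obtain ⟨z, hz⟩ := hl
      refine ⟨TensorProduct.comm K _ _ z, ?_⟩
      rw [← comm_comul K x, ← hz, LinearMap.rTensor, LinearMap.lTensor, TensorProduct.map_comm]
    exact (Subalgebra.toSubmodule S).mem_range_map_subtype hr hl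

lemma mem_equalizer {u v : H →ₐc[K] P} {x : H} : x ∈ (equalizer u v).toSubalgebra ↔
    (u : H →ₗ[K] P).lTensor H (comul (R := K) x) = (v : H →ₗ[K] P).lTensor H (comul (R := K) x) :=
  Iff.rfl

lemma eq_of_mem_equalizer {u v : H →ₐc[K] P} {x : H}
    (hx : x ∈ (equalizer u v).toSubalgebra) : u x = v x := by
  have key (w : H →ₐc[K] P) : TensorProduct.lid K P ((counit (R := K)).rTensor P
      ((w : H →ₗ[K] P).lTensor H (comul (R := K) x))) = w x := by
    rw [← LinearMap.comp_apply (LinearMap.rTensor _ _), LinearMap.rTensor_comp_lTensor,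
      ← LinearMap.lTensor_comp_rTensor, LinearMap.comp_apply, rTensor_counit_comul]
    simp
  rw [← key u, ← key v, mem_equalizer.mp hx]

/-- A coalgebra morphism that equalizes `u` and `v` takes values in their equalizer. -/
lemma mem_equalizer_of_comp_eq {u v : H →ₐc[K] P} (c : T →ₗc[K] H) (h : ∀ t, u (c t) = v (c t))
    (t : T) : c t ∈ (equalizer u v).toSubalgebra := by
  rw [mem_equalizer, ← CoalgHomClass.map_comp_comul_apply]
  induction comul (R := K) t with
  | zero => simp
  | add z w hz hw => simp only [map_add, hz, hw]
  | tmul a b => simp [h b]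

end SubBialgebra

end Equalizer

/-! ### The convolution monoid of coalgebra morphisms -/

section Convolution

open WithConv

namespace CoalgHom

variable {K T U A : Type*} [Field K] [AddCommGroup T] [Module K T] [Coalgebra K T]
  [AddCommGroup U] [Module K U] [Coalgebra K U] [Ring A] [Bialgebra K A]

/-- The unit for convolution, `t ↦ ε(t) 1`. -/
noncomputable def convUnit (K T A : Type*) [Field K] [AddCommGroup T] [Module K T] [Coalgebra K T]
    [Ring A] [Bialgebra K A] : T →ₗc[K] A :=
  (Bialgebra.unitBialgHom K A : K →ₗc[K] A).comp (counitCoalgHom K T)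

lemma toConv_convUnit : toConv (convUnit K T A : T →ₗ[K] A) = 1 := rfl

lemma toConv_injective : Function.Injective fun c : T →ₗc[K] A => toConv (c : T →ₗ[K] A) :=
  WithConv.toConv_injective.comp coe_linearMap_injective

@[simp] lemma convUnit_comp (e : U →ₗc[K] T) : (convUnit K T A).comp e = convUnit K U A := by
  rw [convUnit, comp_assoc, Subsingleton.elim ((counitCoalgHom K T).comp e) (counitCoalgHom K U)]
  rfl

variable [IsCocomm K T] [IsCocomm K U]

/-- The convolution product of two coalgebra morphisms, which is again a coalgebra morphism because
`T` is cocommutative. -/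
noncomputable def conv (c d : T →ₗc[K] A) : T →ₗc[K] A :=
  (Bialgebra.mulCoalgHom K A).comp ((Coalgebra.TensorProduct.map c d).comp (comulCoalgHom K T))

lemma toConv_conv (c d : T →ₗc[K] A) : toConv (conv c d : T →ₗ[K] A) =
    toConv (c : T →ₗ[K] A) * toConv (d : T →ₗ[K] A) := rfl

lemma conv_assoc (b c d : T →ₗc[K] A) : conv (conv b c) d = conv b (conv c d) :=
  toConv_injective <| by simp only [toConv_conv, mul_assoc]

@[simp] lemma conv_convUnit (c : T →ₗc[K] A) : conv c (convUnit K T A) = c :=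
  toConv_injective <| by simp only [toConv_conv, toConv_convUnit, mul_one]

@[simp] lemma convUnit_conv (c : T →ₗc[K] A) : conv (convUnit K T A) c = c :=
  toConv_injective <| by simp only [toConv_conv, toConv_convUnit, one_mul]

lemma conv_comp (c d : T →ₗc[K] A) (e : U →ₗc[K] T) :
    (conv c d).comp e = conv (c.comp e) (d.comp e) :=
  coe_linearMap_injective <| LinearMap.convMul_comp_coalgHom_distrib
    (toConv (c : T →ₗ[K] A)) (toConv (d : T →ₗ[K] A)) e

end CoalgHom

open CoalgHom

lemma BialgHom.comp_conv {K T A B : Type*} [Field K] [AddCommGroup T] [Module K T] [Coalgebra K T]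
    [IsCocomm K T] [Ring A] [Bialgebra K A] [Ring B] [Bialgebra K B] (f : A →ₐc[K] B)
    (c d : T →ₗc[K] A) :
    (f : A →ₗc[K] B).comp (conv c d) =
      conv ((f : A →ₗc[K] B).comp c) ((f : A →ₗc[K] B).comp d) :=
  CoalgHom.coe_linearMap_injective <| LinearMap.algHom_comp_convMul_distrib (f : A →ₐ[K] B)
    (toConv (c : T →ₗ[K] A)) (toConv (d : T →ₗ[K] A))

/-- In a cocommutative Hopf algebra the antipode is a coalgebra morphism: both `Δ ∘ S` and
`(S ⊗ S) ∘ Δ` are convolution inverses of `Δ`. -/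
noncomputable def HopfAlgebra.antipodeCoalgHom (K H : Type*) [Field K] [Ring H] [HopfAlgebra K H]
    [IsCocomm K H] : H →ₗc[K] H where
  __ := HopfAlgebra.antipode K
  counit_comp := HopfAlgebra.counit_comp_antipode
  map_comp_comul := by
    have h₁ : toConv (comul (R := K) (A := H)) *
        toConv (comul (R := K) ∘ₗ HopfAlgebra.antipode K) = 1 := LinearMap.comul_right_inv
    have h₂ : toConv (TensorProduct.map (HopfAlgebra.antipode K) (HopfAlgebra.antipode K) ∘ₗ
        comul (R := K) (A := H)) * toConv (comul (R := K)) = 1 := by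
      have h := LinearMap.convMul_comp_coalgHom_distrib (B := H)
        (toConv (TensorProduct.map (HopfAlgebra.antipode K (A := H))
          (HopfAlgebra.antipode K (A := H))))
        (toConv (TensorProduct.map LinearMap.id LinearMap.id)) (comulCoalgHom K H)
      have h' := TensorProduct.map_convMul_map (f := toConv (HopfAlgebra.antipode K (A := H)))
        (g := toConv (HopfAlgebra.antipode K (A := H))) (h := toConv LinearMap.id)
        (k := toConv LinearMap.id)
      rw [LinearMap.antipode_mul_id] at h'
      erw [h', TensorProduct.map_id] at h
      apply WithConv.ext
      refine h.symm.trans ?_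
      ext x
      have hc (z : H ⊗[K] H) : TensorProduct.map (1 : WithConv (H →ₗ[K] H)).ofConv
          (1 : WithConv (H →ₗ[K] H)).ofConv z =
          algebraMap K (H ⊗[K] H) (counit (R := K) (TensorProduct.lid K H
            ((counit (R := K)).rTensor H z))) := by
        induction z with
        | zero => simp
        | add z w hz hw => simp only [map_add, hz, hw]
        | tmul a b =>
          simp [Algebra.algebraMap_eq_smul_one, mul_smul, TensorProduct.smul_tmul',
            Algebra.TensorProduct.one_def, smul_comm (counit (R := K) a)]
      refine (hc _).trans ?_
      erw [rTensor_counit_comul]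
      simp
    exact congrArg ofConv (left_inv_eq_right_inv h₂ h₁)

end Convolution

/-! ### Coalgebra morphisms into cocommutative bialgebras -/

namespace CocommBialgCat

open CoalgHom

variable {K : Type u} [Field K] {T : Type*} [AddCommGroup T] [Module K T] [Coalgebra K T]

instance (X : CocommBialgCat K) : IsCocomm K X.obj := X.property

/-- A bialgebra morphism, as a morphism of the category of cocommutative bialgebras. -/
abbrev ofHom {A B : Type u} [Ring A] [Bialgebra K A] [IsCocomm K A] [Ring B] [Bialgebra K B]
    [IsCocomm K B] (f : A →ₐc[K] B) : of K A ⟶ of K B :=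
  ObjectProperty.homMk (BialgCat.ofHom f)

/-- The bialgebra morphism underlying a morphism of cocommutative bialgebras. -/
abbrev toBialgHom {X Y : CocommBialgCat K} (f : X ⟶ Y) : X.obj →ₐc[K] Y.obj :=
  f.hom.toBialgHom

/-- The coalgebra morphism underlying a morphism of cocommutative bialgebras. -/
noncomputable def toCoalgHom {X Y : CocommBialgCat K} (f : X ⟶ Y) : X.obj →ₗc[K] Y.obj :=
  (toBialgHom f : X.obj →ₗc[K] Y.obj)

lemma toBialgHom_injective {X Y : CocommBialgCat K} :
    Function.Injective (toBialgHom : (X ⟶ Y) → _) := fun _ _ h =>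
  ObjectProperty.hom_ext _ (BialgCat.hom_ext _ _ h)

lemma toCoalgHom_comp {X Y Z : CocommBialgCat K} (f : X ⟶ Y) (g : Y ⟶ Z) :
    toCoalgHom (f ≫ g) = (toCoalgHom g).comp (toCoalgHom f) := rfl

lemma toCoalgHom_comp_conv [IsCocomm K T] {X Y : CocommBialgCat K} (f : X ⟶ Y)
    (c d : T →ₗc[K] X.obj) : (toCoalgHom f).comp (conv c d) =
      conv ((toCoalgHom f).comp c) ((toCoalgHom f).comp d) :=
  (toBialgHom f).comp_conv c d

@[simp] lemma toCoalgHom_comp_convUnit {X Y : CocommBialgCat K} (f : X ⟶ Y) :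
    (toCoalgHom f).comp (convUnit K T X.obj) = convUnit K T Y.obj := by
  ext t
  exact (toBialgHom f : X.obj →ₐ[K] Y.obj).commutes (counit (R := K) t)

lemma isIso_of_comp_eq_id {X Y : CocommBialgCat K} (f : X ⟶ Y) (c : Y.obj →ₗc[K] X.obj)
    (h₁ : (toCoalgHom f).comp c = CoalgHom.id K _) (h₂ : c.comp (toCoalgHom f) = CoalgHom.id K _) :
    IsIso f := by
  have : IsIso ((forget (BialgCat K)).map f.hom) :=
    (isIso_iff_bijective _).mpr (Function.bijective_iff_has_inverse.mpr
      ⟨c, CoalgHom.congr_fun h₂, CoalgHom.congr_fun h₁⟩)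
  have := isIso_of_reflects_iso f.hom (forget (BialgCat K))
  exact (ObjectProperty.isIso_hom_iff f).mp this

/-- The projection `a ⊗ b ↦ ε(b) a`. -/
noncomputable def projLeft (A B : Type*) [Ring A] [Bialgebra K A] [Ring B] [Bialgebra K B] :
    A ⊗[K] B →ₐc[K] A :=
  (Bialgebra.TensorProduct.rid K K A : A ⊗[K] K →ₐc[K] A).comp
    (Bialgebra.TensorProduct.map (BialgHom.id K A) (Bialgebra.counitBialgHom K B))

/-- The projection `a ⊗ b ↦ ε(a) b`. -/
noncomputable def projRight (A B : Type*) [Ring A] [Bialgebra K A] [Ring B] [Bialgebra K B] :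
    A ⊗[K] B →ₐc[K] B :=
  (Bialgebra.TensorProduct.lid K B : K ⊗[K] B →ₐc[K] B).comp
    (Bialgebra.TensorProduct.map (Bialgebra.counitBialgHom K A) (BialgHom.id K B))

section
variable {A B : Type*} [Ring A] [Bialgebra K A] [Ring B] [Bialgebra K B]

@[simp] lemma projLeft_tmul (a : A) (b : B) :
    projLeft (K := K) A B (a ⊗ₜ b) = counit (R := K) b • a := rfl

@[simp] lemma projRight_tmul (a : A) (b : B) :
    projRight (K := K) A B (a ⊗ₜ b) = counit (R := K) a • b := rfl

/-- The coalgebra morphism to a tensor product with given components, `t ↦ c(t₁) ⊗ d(t₂)`. -/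
noncomputable def pair [IsCocomm K T] (c : T →ₗc[K] A) (d : T →ₗc[K] B) : T →ₗc[K] A ⊗[K] B :=
  (Coalgebra.TensorProduct.map c d).comp (comulCoalgHom K T)

@[simp] lemma projLeft_pair [IsCocomm K T] (c : T →ₗc[K] A) (d : T →ₗc[K] B) (t : T) :
    projLeft (K := K) A B (pair c d t) = c t := by
  have h (z : T ⊗[K] T) : projLeft (K := K) A B (Coalgebra.TensorProduct.map c d z) =
      c (TensorProduct.rid K T ((counit (R := K)).lTensor T z)) := by
    induction z with
    | zero => simp
    | add z w hz hw => simp only [map_add, hz, hw]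
    | tmul x y => simp
  exact (h _).trans (by erw [lTensor_counit_comul]; simp)

@[simp] lemma projRight_pair [IsCocomm K T] (c : T →ₗc[K] A) (d : T →ₗc[K] B) (t : T) :
    projRight (K := K) A B (pair c d t) = d t := by
  have h (z : T ⊗[K] T) : projRight (K := K) A B (Coalgebra.TensorProduct.map c d z) =
      d (TensorProduct.lid K T ((counit (R := K)).rTensor T z)) := by
    induction z with
    | zero => simp
    | add z w hz hw => simp only [map_add, hz, hw]
    | tmul x y => simp
  exact (h _).trans (by erw [rTensor_counit_comul]; simp)

end

/-- A monomorphism of cocommutative bialgebras is a monomorphism with respect to coalgebra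
morphisms: the two morphisms pair to a coalgebra morphism into the kernel pair, which is a
bialgebra. -/
lemma eq_of_comp_mono_eq [IsCocomm K T] {M P : CocommBialgCat K} (m : M ⟶ P) [Mono m]
    {c d : T →ₗc[K] M.obj} (h : (toCoalgHom m).comp c = (toCoalgHom m).comp d) : c = d := by
  let pl := projLeft (K := K) M.obj M.obj
  let pr := projRight (K := K) M.obj M.obj
  let E := SubBialgebra.equalizer ((toBialgHom m).comp pl) ((toBialgHom m).comp pr)
  let il : of K E.Carrier ⟶ M := ofHom (pl.comp E.incl)
  let ir : of K E.Carrier ⟶ M := ofHom (pr.comp E.incl)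
  have hE : il = ir := by
    rw [← cancel_mono m]
    apply toBialgHom_injective
    ext x
    exact SubBialgebra.eq_of_mem_equalizer (u := (toBialgHom m).comp pl)
      (v := (toBialgHom m).comp pr) x.2
  ext t
  have ht : pair c d t ∈ E.toSubalgebra := by
    refine SubBialgebra.mem_equalizer_of_comp_eq (pair c d) (fun t => ?_) t
    have hl : pl (pair c d t) = c t := projLeft_pair c d t
    have hr : pr (pair c d t) = d t := projRight_pair c d t
    change toBialgHom m (pl _) = toBialgHom m (pr _)
    rw [hl, hr]
    exact CoalgHom.congr_fun h t
  rw [← projLeft_pair c d t, ← projRight_pair c d t]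
  exact BialgHom.congr_fun (congrArg toBialgHom hE) ⟨_, ht⟩

/-- The projections of a pullback are jointly monic with respect to coalgebra morphisms. -/
lemma eq_of_isPullback [IsCocomm K T] {P X W Y : CocommBialgCat K} {q : P ⟶ X} {p : P ⟶ W}
    {f : X ⟶ Y} {g : W ⟶ Y} (hP : IsPullback q p f g) {c d : T →ₗc[K] P.obj}
    (hq : (toCoalgHom q).comp c = (toCoalgHom q).comp d)
    (hp : (toCoalgHom p).comp c = (toCoalgHom p).comp d) : c = d := by
  let j : P.obj →ₐc[K] X.obj ⊗[K] W.obj :=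
    (Bialgebra.TensorProduct.map (toBialgHom q) (toBialgHom p)).comp
      (Bialgebra.comulBialgHom K P.obj)
  let j' : P ⟶ of K (X.obj ⊗[K] W.obj) := ofHom j
  let l : of K (X.obj ⊗[K] W.obj) ⟶ X := ofHom (projLeft X.obj W.obj)
  let r : of K (X.obj ⊗[K] W.obj) ⟶ W := ofHom (projRight X.obj W.obj)
  have hjq : j' ≫ l = q := by
    apply toBialgHom_injective
    ext x
    exact projLeft_pair (toCoalgHom q) (toCoalgHom p) x
  have hjp : j' ≫ r = p := by
    apply toBialgHom_injective
    ext x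
    exact projRight_pair (toCoalgHom q) (toCoalgHom p) x
  have : Mono j' := ⟨fun a b hab => hP.hom_ext
    (by rw [← hjq, ← Category.assoc, hab, Category.assoc])
    (by rw [← hjp, ← Category.assoc, hab, Category.assoc])⟩
  apply eq_of_comp_mono_eq j'
  have key (e : T →ₗc[K] P.obj) : (toCoalgHom j').comp e =
      pair ((toCoalgHom q).comp e) ((toCoalgHom p).comp e) := by
    ext t
    change TensorProduct.map (toCoalgHom q).toLinearMap (toCoalgHom p).toLinearMap
      (comul (R := K) (e t)) = TensorProduct.map
        ((toCoalgHom q).toLinearMap ∘ₗ e.toLinearMap) ((toCoalgHom p).toLinearMap ∘ₗ e.toLinearMap)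
        (comul (R := K) t)
    rw [TensorProduct.map_comp, ← CoalgHomClass.map_comp_comul_apply]
    rfl
  rw [key, key, hq, hp]

/-- The kernel of a pulled back split epimorphism is a kernel of the original one, also with
respect to coalgebra morphisms. -/
lemma exists_lift_ker {W Y : CocommBialgCat K} {E' : SplitExtension W} {E : SplitExtension Y}
    {g : W ⟶ Y} {q : E'.mid ⟶ E.mid} (hq : E'.IsPullbackAlong E g q) (c : T →ₗc[K] E.mid.obj)
    (hc : (toCoalgHom E.f).comp c = convUnit K T Y.obj) :
    ∃ c' : T →ₗc[K] E'.ker.obj, (toCoalgHom q).comp ((toCoalgHom E'.k).comp c') = c := by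
  let S := SubBialgebra.equalizer (toBialgHom E.f) (toBialgHom (0 : E.mid ⟶ Y))
  let i : of K S.Carrier ⟶ E.mid := ofHom S.incl
  have hi : i ≫ E.f = 0 ≫ g := by
    rw [zero_comp]
    apply toBialgHom_injective
    ext x
    exact SubBialgebra.eq_of_mem_equalizer (u := toBialgHom E.f)
      (v := toBialgHom (0 : E.mid ⟶ Y)) x.2
  let l := hq.isPullback.lift i 0 hi
  have hl : l ≫ E'.f = 0 := hq.isPullback.lift_snd _ _ _
  obtain ⟨r, hr⟩ := KernelFork.IsLimit.lift' E'.isKernel l hl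
  have hr' : (r ≫ E'.k) ≫ q = i := by
    rw [show r ≫ E'.k = l from hr]; exact hq.isPullback.lift_fst _ _ _
  have hS (t : T) : c t ∈ S.toSubalgebra :=
    SubBialgebra.mem_equalizer_of_comp_eq c (fun t => (CoalgHom.congr_fun hc t).trans
      (CoalgHom.congr_fun (convUnit_comp (A := Y.obj) c) t).symm) t
  refine ⟨(toCoalgHom r).comp (S.coalgCodRestrict c hS), ?_⟩
  ext t
  exact CoalgHom.congr_fun (congrArg toCoalgHom hr') (S.coalgCodRestrict c hS t)

/-- Over a Hopf algebra, all pullbacks of a split extension are strong. With the coalgebra morphism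
`π = id * (s ∘ S ∘ f)` from the middle object to the kernel, every element decomposes as
`x = π(x₁) s(f(x₂))`; such a decomposition passes to pullbacks, and to every subobject that contains
the kernel and the section. -/
theorem isStablyStrong_of_antipode {Y : CocommBialgCat K} (S : Y.obj →ₗc[K] Y.obj)
    (hS₁ : conv S (CoalgHom.id K _) = convUnit K _ _)
    (hS₂ : conv (CoalgHom.id K _) S = convUnit K _ _) (E : SplitExtension Y) :
    E.IsStablyStrong := by
  intro W g E' q hq M m _ a b ha hb
  let f := toCoalgHom E.f
  let s := toCoalgHom E.s
  have hfs : f.comp s = CoalgHom.id K _ := congrArg toCoalgHom E.section_comp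
  let π := conv (CoalgHom.id K _) (s.comp (S.comp f))
  have hfπ : f.comp π = convUnit K _ _ := by
    have : f.comp π = (conv (CoalgHom.id K _) S).comp f := by
      rw [conv_comp, toCoalgHom_comp_conv E.f, ← CoalgHom.comp_assoc, hfs, CoalgHom.id_comp,
        CoalgHom.id_comp, CoalgHom.comp_id]
    rw [this, hS₂, convUnit_comp]
  have hπ : conv π (s.comp f) = CoalgHom.id K _ := by
    have : conv (s.comp (S.comp f)) (s.comp f) =
        s.comp ((conv S (CoalgHom.id K _)).comp f) := by
      rw [conv_comp, toCoalgHom_comp_conv E.s, CoalgHom.id_comp]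
    rw [conv_assoc, this, hS₁, convUnit_comp, toCoalgHom_comp_convUnit E.s, conv_convUnit]
  obtain ⟨τ, hτ⟩ := exists_lift_ker hq (π.comp (toCoalgHom q)) (by
    rw [← CoalgHom.comp_assoc, hfπ, convUnit_comp])
  let k' := toCoalgHom E'.k
  let σ := toCoalgHom E'.s
  let p := toCoalgHom E'.f
  have hdecomp : conv (k'.comp τ) (σ.comp p) = CoalgHom.id K _ := by
    apply eq_of_isPullback hq.isPullback
    · have h₁ : (toCoalgHom q).comp (σ.comp p) = (s.comp f).comp (toCoalgHom q) := by
        have : E'.f ≫ E'.s ≫ q = q ≫ E.f ≫ E.s := by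
          rw [hq.section_comp_proj, ← Category.assoc, ← hq.isPullback.w, Category.assoc]
        exact congrArg toCoalgHom this
      rw [toCoalgHom_comp_conv, hτ, h₁, ← conv_comp, hπ, CoalgHom.id_comp, CoalgHom.comp_id]
    · have h₁ : p.comp (σ.comp p) = p := by
        rw [← CoalgHom.comp_assoc, show p.comp σ = CoalgHom.id K _ from
          congrArg toCoalgHom E'.section_comp, CoalgHom.id_comp]
      have h₂ : p.comp (k'.comp τ) = convUnit K _ _ := by
        rw [← CoalgHom.comp_assoc, show p.comp k' = convUnit K _ _ from
          congrArg toCoalgHom E'.kernel_comp, convUnit_comp]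
      rw [toCoalgHom_comp_conv, h₁, h₂, convUnit_conv, CoalgHom.comp_id]
  have hmρ : (toCoalgHom m).comp (conv ((toCoalgHom a).comp τ) ((toCoalgHom b).comp p)) =
      CoalgHom.id K _ := by
    rw [toCoalgHom_comp_conv, ← CoalgHom.comp_assoc, ← CoalgHom.comp_assoc, ← toCoalgHom_comp,
      ← toCoalgHom_comp, ha, hb, hdecomp]
  refine isIso_of_comp_eq_id m _ hmρ (eq_of_comp_mono_eq m ?_)
  rw [← CoalgHom.comp_assoc, hmρ, CoalgHom.id_comp, CoalgHom.comp_id]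

lemma isProtomodularObject_of_isHopfAlgebra (Y : Type u) [Ring Y] [Bialgebra K Y] [IsCocomm K Y]
    (hY : IsHopfAlgebra K Y) : IsProtomodularObject (of K Y) := by
  obtain ⟨H, rfl⟩ := hY
  refine isStablyStrong_of_antipode (Y := of K Y) (HopfAlgebra.antipodeCoalgHom K Y) ?_ ?_
  · exact CoalgHom.toConv_injective (LinearMap.antipode_mul_id (R := K) (C := Y))
  · exact CoalgHom.toConv_injective (LinearMap.id_mul_antipode (R := K) (C := Y))

end CocommBialgCat

lemma SplitExtension.isPullbackAlong_id {C : Type u} [Category.{v} C] [HasZeroMorphisms C] {Y : C}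
    (E : SplitExtension Y) : E.IsPullbackAlong E (𝟙 Y) (𝟙 E.mid) where
  isPullback := IsPullback.of_horiz_isIso ⟨by simp⟩
  section_comp_proj := by simp

lemma IsProtomodularObject.isStrong {C : Type u} [Category.{v} C] [HasZeroMorphisms C] {Y : C}
    (hY : IsProtomodularObject Y) (E : SplitExtension Y) : E.IsStrong :=
  hY E (𝟙 Y) E (𝟙 E.mid) E.isPullbackAlong_id

/-! ### The dual algebra of a cocommutative coalgebra and group-like elements -/

section Characters

variable {K A B : Type*} [Field K] [CommRing A] [Algebra K A] [CommRing B] [Algebra K B]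

/-- Over an algebraically closed field, a prime ideal of finite codimension is the kernel of a
character. -/
lemma Ideal.IsPrime.exists_algHom_of_finite [IsAlgClosed K] {I P : Ideal B}
    [Module.Finite K (B ⧸ I)] (hP : P.IsPrime) (hIP : I ≤ P) :
    ∃ χ : B →ₐ[K] K, ∀ b, b ∈ P ↔ χ b = 0 := by
  have : Module.Finite K (B ⧸ P) :=
    Module.Finite.of_surjective (Ideal.Quotient.factorₐ K hIP).toLinearMap
      (Ideal.Quotient.factor_surjective hIP)
  have : Algebra.IsIntegral K (B ⧸ P) := Algebra.IsIntegral.of_finite K (B ⧸ P)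
  let e := AlgEquiv.ofBijective (Algebra.ofId K (B ⧸ P))
    IsAlgClosed.algebraMap_bijective_of_isIntegral
  refine ⟨e.symm.toAlgHom.comp (Ideal.Quotient.mkₐ K P), fun b => ?_⟩
  rw [← Ideal.Quotient.eq_zero_iff_mem, ← map_eq_zero_iff e.symm e.symm.injective]
  rfl

/-- Lying over for an algebra morphism that becomes finite modulo an ideal `I`. -/
lemma Ideal.exists_isPrime_comap_eq_of_finite (p : A →ₐ[K] B) (I : Ideal B)
    [Module.Finite K (B ⧸ I)] (𝔪 : Ideal A) [𝔪.IsMaximal] (h : ∀ a, p a ∈ I → a ∈ 𝔪) :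
    ∃ P : Ideal B, P.IsPrime ∧ I ≤ P ∧ ∀ a, p a ∈ P ↔ a ∈ 𝔪 := by
  let f : A →ₐ[K] B ⧸ I := (Ideal.Quotient.mkₐ K I).comp p
  let _ : Algebra A (B ⧸ I) := f.toRingHom.toAlgebra
  have : IsScalarTower K A (B ⧸ I) := IsScalarTower.of_algebraMap_eq fun r => (f.commutes r).symm
  have : Algebra.IsIntegral K (B ⧸ I) := Algebra.IsIntegral.of_finite K (B ⧸ I)
  have : Algebra.IsIntegral A (B ⧸ I) :=
    ⟨fun b => (Algebra.IsIntegral.isIntegral (R := K) b).tower_top⟩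
  obtain ⟨Q, hQ, hcomap⟩ := Ideal.exists_ideal_over_maximal_of_isIntegral (S := B ⧸ I) 𝔪
    fun a ha => h a (Ideal.Quotient.eq_zero_iff_mem.mp ha)
  refine ⟨Q.comap (Ideal.Quotient.mk I), inferInstance, fun b hb => ?_, fun a => ?_⟩
  · rw [Ideal.mem_comap, Ideal.Quotient.eq_zero_iff_mem.mpr hb]
    exact Q.zero_mem
  · rw [← hcomap]
    rfl

end Characters

section DualAlgebra

open WithConv

variable {K T U : Type*} [Field K] [AddCommGroup T] [Module K T] [Coalgebra K T]
  [AddCommGroup U] [Module K U] [Coalgebra K U]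

namespace DualAlgebra

/-- The action of the dual algebra on a coalgebra, `φ ⇀ x = x₁ φ(x₂)`. -/
noncomputable def act (φ : WithConv (T →ₗ[K] K)) : T →ₗ[K] T :=
  (TensorProduct.rid K T).toLinearMap ∘ₗ φ.ofConv.lTensor T ∘ₗ comul

lemma act_apply (φ : WithConv (T →ₗ[K] K)) (x : T) :
    act φ x = TensorProduct.rid K T (φ.ofConv.lTensor T (comul x)) := rfl

lemma act_add (φ ψ : WithConv (T →ₗ[K] K)) (x : T) :
    act (φ + ψ) x = act φ x + act ψ x := by
  simp [act_apply, LinearMap.lTensor_add]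

lemma act_smul (r : K) (φ : WithConv (T →ₗ[K] K)) (x : T) :
    act (r • φ) x = r • act φ x := by
  simp [act_apply, LinearMap.lTensor_smul]

lemma act_one (x : T) : act (1 : WithConv (T →ₗ[K] K)) x = x := by
  have : (1 : WithConv (T →ₗ[K] K)).ofConv = counit := rfl
  rw [act_apply, this, lTensor_counit_comul]
  simp

lemma act_mul (φ ψ : WithConv (T →ₗ[K] K)) (x : T) :
    act (φ * ψ) x = act φ (act ψ x) := by
  let F : T ⊗[K] (T ⊗[K] T) →ₗ[K] T := (TensorProduct.rid K T).toLinearMap ∘ₗ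
    (LinearMap.mul' K K ∘ₗ TensorProduct.map φ.ofConv ψ.ofConv).lTensor T
  have h₁ (z : T ⊗[K] T) : act φ (TensorProduct.rid K T (ψ.ofConv.lTensor T z)) =
      F (TensorProduct.assoc K T T T ((comul (R := K)).rTensor T z)) := by
    induction z with
    | zero => simp
    | add z w hz hw => simp only [map_add, hz, hw]
    | tmul a b =>
      simp only [LinearMap.lTensor_tmul, LinearMap.rTensor_tmul, TensorProduct.rid_tmul, map_smul,
        act_apply]
      induction comul (R := K) a with
      | zero => simp
      | add z w hz hw => simp only [map_add, TensorProduct.add_tmul, smul_add, hz, hw]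
      | tmul c d => simp [F, mul_smul, smul_comm (φ d)]
  have h₂ (z : T ⊗[K] T) : TensorProduct.rid K T ((φ * ψ).ofConv.lTensor T z) =
      F ((comul (R := K)).lTensor T z) := by
    induction z with
    | zero => simp
    | add z w hz hw => simp only [map_add, hz, hw]
    | tmul a b => simp [F]
  rw [act_apply, h₂, ← coassoc_apply, ← h₁]
  rfl

lemma counit_act (φ : WithConv (T →ₗ[K] K)) (x : T) :
    counit (R := K) (act φ x) = φ x := by
  have h (z : T ⊗[K] T) : counit (R := K) (TensorProduct.rid K T (φ.ofConv.lTensor T z)) =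
      φ (TensorProduct.lid K T ((counit (R := K)).rTensor T z)) := by
    induction z with
    | zero => simp
    | add z w hz hw => simp only [map_add, hz, hw]
    | tmul a b => simp [mul_comm]
  rw [act_apply, h, rTensor_counit_comul]
  simp

lemma map_act (p : T →ₗc[K] U) (φ : WithConv (U →ₗ[K] K)) (x : T) :
    p (act (toConv (φ.ofConv ∘ₗ (p : T →ₗ[K] U))) x) = act φ (p x) := by
  have h (z : T ⊗[K] T) :
      p (TensorProduct.rid K T ((φ.ofConv ∘ₗ (p : T →ₗ[K] U)).lTensor T z)) =
        TensorProduct.rid K U (φ.ofConv.lTensor U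
          (TensorProduct.map (p : T →ₗ[K] U) (p : T →ₗ[K] U) z)) := by
    induction z with
    | zero => simp
    | add z w hz hw => simp only [map_add, hz, hw]
    | tmul a b => simp
  rw [act_apply, act_apply, h]
  exact congrArg _ (congrArg _ (CoalgHomClass.map_comp_comul_apply p x))

/-- Pairs of linear forms separate the points of a tensor product of vector spaces. -/
lemma eq_zero_of_forall_dual {V W : Type*} [AddCommGroup V] [Module K V] [AddCommGroup W]
    [Module K W] {z : V ⊗[K] W} (h : ∀ (φ : V →ₗ[K] K) (ψ : W →ₗ[K] K),
      LinearMap.mul' K K (TensorProduct.map φ ψ z) = 0) : z = 0 := by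
  let b := Module.Basis.ofVectorSpace K V
  let c := Module.Basis.ofVectorSpace K W
  apply (b.tensorProduct c).ext_elem
  rintro ⟨i, j⟩
  have key : (b.tensorProduct c).coord (i, j) =
      LinearMap.mul' K K ∘ₗ TensorProduct.map (b.coord i) (c.coord j) := by
    ext v w
    simp [Module.Basis.tensorProduct_repr_tmul_apply, mul_comm]
  simpa [h] using LinearMap.congr_fun key z

section Cocomm

variable [IsCocomm K T]

/-- The annihilator of an element under the action of the dual algebra. -/
noncomputable def ann (K : Type*) {T : Type*} [Field K] [AddCommGroup T] [Module K T]
    [Coalgebra K T]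
    [IsCocomm K T] (x : T) : Ideal (WithConv (T →ₗ[K] K)) where
  carrier := {φ | act φ x = 0}
  add_mem' {φ ψ} hφ hψ := by
    simp only [Set.mem_ofPred_eq] at *
    rw [act_add, hφ, hψ, add_zero]
  zero_mem' := by simp [act_apply]
  smul_mem' φ ψ hψ := by
    simp only [Set.mem_ofPred_eq] at *
    rw [smul_eq_mul, act_mul, hψ, map_zero]

lemma mem_ann {x : T} {φ : WithConv (T →ₗ[K] K)} : φ ∈ ann K x ↔ act φ x = 0 := Iff.rfl

/-- The local finiteness of coalgebras: every annihilator has finite codimension. -/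
instance finite_quotient_ann (x : T) :
    Module.Finite K (WithConv (T →ₗ[K] K) ⧸ ann K x) := by
  classical
  let F : WithConv (T →ₗ[K] K) →ₗ[K] T :=
    { toFun := fun φ => act φ x
      map_add' := fun φ ψ => act_add φ ψ x
      map_smul' := fun r φ => act_smul r φ x }
  let V := Submodule.span K (((ℛ K x).index.image (ℛ K x).left : Finset T) : Set T)
  have hF (φ) : F φ ∈ V := by
    have : F φ = ∑ i ∈ (ℛ K x).index, φ ((ℛ K x).right i) • (ℛ K x).left i := by
      change act φ x = _
      rw [act_apply, ← (ℛ K x).eq]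
      simp
    rw [this]
    exact V.sum_mem fun i hi => V.smul_mem _
      (Submodule.subset_span (Finset.mem_coe.mpr (Finset.mem_image_of_mem _ hi)))
  let G : WithConv (T →ₗ[K] K) →ₗ[K] V := F.codRestrict V hF
  have : Module.Finite K V := Module.Finite.span_finset K _
  let G' : (WithConv (T →ₗ[K] K) ⧸ (ann K x).restrictScalars K) →ₗ[K] V :=
    Submodule.liftQ _ G fun φ hφ => Subtype.ext hφ
  have hG' : Function.Injective G' := by
    rw [← LinearMap.ker_eq_bot, LinearMap.ker_eq_bot']
    intro φ hφ
    obtain ⟨φ, rfl⟩ := Submodule.Quotient.mk_surjective _ φ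
    exact (Submodule.Quotient.mk_eq_zero _).mpr (congrArg Subtype.val hφ)
  exact Module.Finite.of_injective G' hG'

/-- The characters of the dual algebra that factor through a finite-dimensional quotient are the
evaluations at group-like elements. -/
lemma exists_isGroupLikeElem_of_character (χ : WithConv (T →ₗ[K] K) →ₐ[K] K) (x : T)
    (hχ : ∀ φ ∈ ann K x, χ φ = 0) : ∃ d : T, IsGroupLikeElem K d ∧ ∀ φ, χ φ = φ d := by
  let ev (t : T) : WithConv (T →ₗ[K] K) →ₗ[K] K :=
    { toFun := fun φ => φ t
      map_add' := fun _ _ => rfl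
      map_smul' := fun _ _ => rfl }
  have hspan : χ.toLinearMap ∈ Submodule.span K
      (Set.range fun i : (ℛ K x).index => ev ((ℛ K x).right i)) := by
    refine mem_span_of_iInf_ker_le_ker fun φ hφ => hχ φ ?_
    rw [mem_ann, act_apply, ← (ℛ K x).eq, map_sum, map_sum]
    refine Finset.sum_eq_zero fun i hi => ?_
    have : φ ((ℛ K x).right i) = 0 := (Submodule.mem_iInf _).mp hφ ⟨i, hi⟩
    simp [this]
  obtain ⟨c, hc⟩ := (Submodule.mem_span_range_iff_exists_fun K).mp hspan
  have hd (φ) : χ φ = φ (∑ i, c i • (ℛ K x).right i) := by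
    rw [← AlgHom.toLinearMap_apply, ← hc, map_sum]
    simp only [LinearMap.sum_apply, LinearMap.smul_apply, map_smul]
    rfl
  refine ⟨∑ i, c i • (ℛ K x).right i, ⟨?_, ?_⟩, hd⟩
  · exact (hd 1).symm.trans (map_one χ)
  · rw [← sub_eq_zero]
    refine eq_zero_of_forall_dual fun φ ψ => ?_
    have := (hd (toConv φ * toConv ψ)).symm.trans (map_mul χ _ _)
    rw [hd, hd] at this
    rw [map_sub, map_sub, sub_eq_zero]
    exact this

/-- Over an algebraically closed field, a prime ideal of the dual algebra that contains the
annihilator of an element is the vanishing ideal of a group-like element. -/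
lemma exists_isGroupLikeElem_of_isPrime [IsAlgClosed K] (x : T) (P : Ideal (WithConv (T →ₗ[K] K)))
    [P.IsPrime] (hP : ann K x ≤ P) :
    ∃ d : T, IsGroupLikeElem K d ∧ ∀ φ, φ ∈ P ↔ φ d = 0 := by
  obtain ⟨χ, hχ⟩ := Ideal.IsPrime.exists_algHom_of_finite (K := K) ‹P.IsPrime› hP
  obtain ⟨d, hd, h⟩ := exists_isGroupLikeElem_of_character χ x fun φ hφ => (hχ φ).mp (hP hφ)
  exact ⟨d, hd, fun φ => by rw [← h φ, hχ]⟩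

end Cocomm

/-- Group-like elements lift along morphisms of cocommutative coalgebras over an algebraically
closed field. Dually, a maximal ideal lies under one of the finite extension
`U^* → T^* / Ann(x)`. -/
theorem exists_isGroupLikeElem_map_eq [IsAlgClosed K] [IsCocomm K T] [IsCocomm K U]
    (p : T →ₗc[K] U) (x : T) (hx : IsGroupLikeElem K (p x)) :
    ∃ d : T, IsGroupLikeElem K d ∧ p d = p x := by
  let ps : WithConv (U →ₗ[K] K) →ₐ[K] WithConv (T →ₗ[K] K) :=
    { toFun := fun φ => toConv (φ.ofConv ∘ₗ (p : T →ₗ[K] U))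
      map_one' := WithConv.ext (CoalgHomClass.counit_comp p)
      map_mul' := fun φ ψ => WithConv.ext (LinearMap.convMul_comp_coalgHom_distrib φ ψ p)
      map_zero' := rfl
      map_add' := fun φ ψ => rfl
      commutes' := fun r => WithConv.ext (by
        ext t
        exact congrArg (r • ·) (CoalgHomClass.counit_comp_apply p t)) }
  let evg : WithConv (U →ₗ[K] K) →+* K :=
    { toFun := fun φ => φ (p x)
      map_one' := hx.counit_eq_one
      map_mul' := fun φ ψ => by simp [hx]
      map_zero' := rfl
      map_add' := fun φ ψ => rfl }
  have hevg : Function.Surjective evg := fun r => ⟨r • 1, by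
    change r • counit (p x) = r
    rw [hx.counit_eq_one, smul_eq_mul, mul_one]⟩
  have : (RingHom.ker evg).IsMaximal := RingHom.ker_isMaximal_of_surjective evg hevg
  obtain ⟨P, hP, hann, hcomap⟩ := Ideal.exists_isPrime_comap_eq_of_finite ps (ann K x)
    (RingHom.ker evg) fun φ hφ => by
      have h₁ := map_act p φ x
      rw [show act (toConv (φ.ofConv ∘ₗ (p : T →ₗ[K] U))) x = 0 from hφ, map_zero] at h₁
      have h₂ := counit_act φ (p x)
      rw [← h₁, map_zero] at h₂
      exact h₂.symm
  obtain ⟨d, hd, h⟩ := exists_isGroupLikeElem_of_isPrime x P hann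
  refine ⟨d, hd, ?_⟩
  have key (φ : WithConv (U →ₗ[K] K)) (hφ : φ (p x) = 0) : φ (p d) = 0 :=
    (h (ps φ)).mp ((hcomap φ).mpr hφ)
  rw [← sub_eq_zero, ← Module.forall_dual_apply_eq_zero_iff K]
  intro φ
  -- `φ - φ(p x) ε` vanishes at the group-like element `p x`.
  have := key (toConv (φ - φ (p x) • counit)) (by simp [hx.counit_eq_one])
  simpa [hd.counit_eq_one] using this

end DualAlgebra

end DualAlgebra

/-! ### Antipodes from inverses of group-like elements -/

section Antipode

open WithConv DualAlgebra

namespace GroupLike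

variable {K T V : Type*} [Field K] [AddCommGroup T] [Module K T] [Coalgebra K T]
  [AddCommGroup V] [Module K V]

lemma mul'_map_map_id_comul (h : T →ₗ[K] V) (φ : V →ₗ[K] K) (ψ : T →ₗ[K] K) (x : T) :
    LinearMap.mul' K K (TensorProduct.map φ ψ (TensorProduct.map h LinearMap.id (comul x))) =
      φ (h (act (toConv ψ) x)) := by
  rw [act_apply]
  induction comul (R := K) x with
  | zero => simp
  | add z w hz hw => simp only [map_add, hz, hw]
  | tmul a b => simp [mul_comm]

lemma map_id_comul_eq_zero {h : T →ₗ[K] V} {x : T}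
    (hx : ∀ φ : WithConv (T →ₗ[K] K), h (act φ x) = 0) :
    TensorProduct.map h LinearMap.id (comul (R := K) x) = 0 := by
  refine eq_zero_of_forall_dual fun φ ψ => ?_
  rw [mul'_map_map_id_comul, hx, map_zero]

lemma map_id_comul_eq_tmul {h : T →ₗ[K] V} {x g : T}
    (hx : ∀ φ : WithConv (T →ₗ[K] K), h (act φ x) = φ g • h x) :
    TensorProduct.map h LinearMap.id (comul (R := K) x) = h x ⊗ₜ g := by
  rw [← sub_eq_zero]
  refine eq_zero_of_forall_dual fun φ ψ => ?_
  rw [map_sub, map_sub, mul'_map_map_id_comul, hx, sub_eq_zero]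
  simp [mul_comm]

lemma map_comul_eq_lTensor {A : Type*} [AddCommGroup A] [Module K A] (h : T →ₗ[K] V)
    (k : T →ₗ[K] A) (x : T) : TensorProduct.map h k (comul (R := K) x) =
      k.lTensor V (TensorProduct.map h LinearMap.id (comul (R := K) x)) := by
  rw [← LinearMap.comp_apply (LinearMap.lTensor _ _), LinearMap.lTensor_comp_map,
    LinearMap.comp_id]

variable [IsCocomm K T]

/-- The vanishing ideal of a group-like element in the dual algebra. -/
def vanishingIdeal (g : GroupLike K T) : Ideal (WithConv (T →ₗ[K] K)) where
  carrier := {φ | φ g.val = 0}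
  add_mem' {φ ψ} hφ hψ := by
    simp only [Set.mem_ofPred_eq] at *
    simp [hφ, hψ]
  zero_mem' := rfl
  smul_mem' φ ψ hψ := by
    simp only [Set.mem_ofPred_eq] at *
    simp [hψ]

/-- The elements annihilated by the product of the vanishing ideals of the group-like elements
in `Z`. -/
noncomputable def layer (Z : Multiset (GroupLike K T)) : Submodule K T where
  carrier := {x | (Z.map vanishingIdeal).prod ≤ ann K x}
  add_mem' {x y} hx hy φ hφ := by
    have h₁ : act φ x = 0 := hx hφ
    have h₂ : act φ y = 0 := hy hφ
    change act φ (x + y) = 0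
    rw [map_add, h₁, h₂, add_zero]
  zero_mem' φ _ := map_zero (act φ)
  smul_mem' r x hx φ hφ := by
    have h₁ : act φ x = 0 := hx hφ
    change act φ (r • x) = 0
    rw [map_smul, h₁, smul_zero]

lemma act_mem_layer {Z : Multiset (GroupLike K T)} {x : T} (hx : x ∈ layer Z)
    (φ : WithConv (T →ₗ[K] K)) : act φ x ∈ layer Z := fun ψ hψ => by
  change act ψ (act φ x) = 0
  rw [← act_mul]
  exact hx (Ideal.mul_mem_right φ _ hψ)

lemma layer_le_layer_add_right (Z Z' : Multiset (GroupLike K T)) : layer Z ≤ layer (Z + Z') :=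
  fun x hx => by
    change ((Z + Z').map vanishingIdeal).prod ≤ _
    rw [Multiset.map_add, Multiset.prod_add]
    exact Ideal.mul_le_left.trans (show _ ≤ ann K x from hx)

lemma layer_le_layer_add_left (Z Z' : Multiset (GroupLike K T)) : layer Z' ≤ layer (Z + Z') := by
  rw [add_comm]
  exact layer_le_layer_add_right Z' Z

/-- Over an algebraically closed field, the layers exhaust a cocommutative coalgebra: in the
noetherian ring `T^* / Ann(x)` some product of primes vanishes. -/
lemma exists_mem_layer [IsAlgClosed K] (x : T) : ∃ Z : Multiset (GroupLike K T), x ∈ layer Z := by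
  have : IsNoetherianRing (WithConv (T →ₗ[K] K) ⧸ ann K x) :=
    IsNoetherianRing.of_finite K _
  obtain ⟨Zp, hZp⟩ := PrimeSpectrum.exists_primeSpectrum_prod_le
    (R := WithConv (T →ₗ[K] K) ⧸ ann K x) ⊥
  suffices ∃ Z : Multiset (GroupLike K T), (Z.map vanishingIdeal).prod ≤
      (Zp.map PrimeSpectrum.asIdeal).prod.comap (Ideal.Quotient.mk (ann K x)) by
    obtain ⟨Z, hZ⟩ := this
    exact ⟨Z, fun φ hφ => Ideal.Quotient.eq_zero_iff_mem.mp (hZp (hZ hφ))⟩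
  clear hZp
  induction Zp using Multiset.induction with
  | empty => exact ⟨0, by simp⟩
  | cons P Zp ih =>
    obtain ⟨Z, hZ⟩ := ih
    obtain ⟨d, hd, h⟩ := exists_isGroupLikeElem_of_isPrime x
      (P.asIdeal.comap (Ideal.Quotient.mk (ann K x))) fun φ hφ => by
        rw [Ideal.mem_comap, Ideal.Quotient.eq_zero_iff_mem.mpr hφ]
        exact P.asIdeal.zero_mem
    refine ⟨⟨d, hd⟩ ::ₘ Z, ?_⟩
    rw [Multiset.map_cons, Multiset.prod_cons, Multiset.map_cons, Multiset.prod_cons]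
    refine Ideal.mul_le.mpr fun φ hφ ψ hψ => ?_
    rw [Ideal.mem_comap, map_mul]
    exact Ideal.mul_mem_mul ((h φ).mpr hφ) (hZ hψ)

variable {A : Type*} [Ring A] [Algebra K A]

lemma conv_comm_apply (h k : WithConv (T →ₗ[K] A)) (x : T) : (k * h).ofConv x =
    LinearMap.mul' K A (TensorProduct.comm K A A
      (TensorProduct.map h.ofConv k.ofConv (comul (R := K) x))) := by
  rw [LinearMap.convMul_apply, ← TensorProduct.map_comm, comm_comul]

lemma conv_eq_zero_of_mem_layer {h k : WithConv (T →ₗ[K] A)} {Z : Multiset (GroupLike K T)}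
    (hh : ∀ x ∈ layer Z, h x = 0) {x : T} (hx : x ∈ layer Z) :
    (h * k).ofConv x = 0 ∧ (k * h).ofConv x = 0 := by
  have key : TensorProduct.map h.ofConv k.ofConv (comul (R := K) x) = 0 := by
    rw [map_comul_eq_lTensor, map_id_comul_eq_zero fun φ => hh _ (act_mem_layer hx φ), map_zero]
  rw [conv_comm_apply h k, LinearMap.convMul_apply, key]
  simp

/-- If `h` vanishes on a layer and `k` at the group-like element `g`, then `h * k` and `k * h`
vanish on the next layer, defined by an additional factor `g`. -/
lemma conv_eq_zero_of_mem_layer_cons {h k : WithConv (T →ₗ[K] A)} {Z : Multiset (GroupLike K T)}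
    {g : GroupLike K T} (hh : ∀ x ∈ layer Z, h x = 0) (hk : k g.val = 0) {x : T}
    (hx : x ∈ layer (g ::ₘ Z)) : (h * k).ofConv x = 0 ∧ (k * h).ofConv x = 0 := by
  have hg (φ : WithConv (T →ₗ[K] K)) : h (act φ x) = φ g.val • h x := by
    let φ₀ : WithConv (T →ₗ[K] K) := φ - φ g.val • 1
    have hφ₀ : φ₀ ∈ g.vanishingIdeal := by
      change φ g.val - φ g.val • counit (R := K) g.val = 0
      simp
    have hmem : act φ₀ x ∈ layer Z := fun ψ hψ => by
      change act ψ (act φ₀ x) = 0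
      rw [← act_mul]
      refine hx ?_
      rw [Multiset.map_cons, Multiset.prod_cons, mul_comm ψ]
      exact Ideal.mul_mem_mul hφ₀ hψ
    have hsum : act φ x = act φ₀ x + φ g.val • x := by
      conv_rhs => rw [← act_one (K := K) x, ← act_smul, act_one, ← act_add, sub_add_cancel]
    rw [hsum, map_add, hh _ hmem, zero_add, map_smul]
  have key : TensorProduct.map h.ofConv k.ofConv (comul (R := K) x) = 0 := by
    rw [map_comul_eq_lTensor, map_id_comul_eq_tmul hg, LinearMap.lTensor_tmul, hk,
      TensorProduct.tmul_zero]
  rw [conv_comm_apply h k, LinearMap.convMul_apply, key]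
  simp

end GroupLike

open GroupLike

variable {K Y : Type*} [Field K] [Ring Y] [Bialgebra K Y] [IsCocomm K Y]

/-- On each layer the identity has left and right convolution inverses: if `h = 1 - L * id` vanishes
on a layer and `c` is the inverse of `g`, then `h * (1 - c * id)` vanishes on the next one, and it
is again of the form `1 - L' * id`. -/
lemma exists_conv_inverse_on_layer (hY : ∀ g : GroupLike K Y, IsUnit g.val)
    (Z : Multiset (GroupLike K Y)) : ∃ L R : WithConv (Y →ₗ[K] Y), ∀ x ∈ layer Z,
      (1 - L * toConv LinearMap.id).ofConv x = 0 ∧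
      (1 - toConv LinearMap.id * R).ofConv x = 0 := by
  let e : WithConv (Y →ₗ[K] Y) := toConv LinearMap.id
  induction Z using Multiset.induction with
  | empty =>
    refine ⟨0, 0, fun x hx => ?_⟩
    have h₁ : act (1 : WithConv (Y →ₗ[K] K)) x = 0 := hx (by simp)
    rw [act_one] at h₁
    simp [h₁]
  | cons g Z ih =>
    obtain ⟨L, R, hLR⟩ := ih
    obtain ⟨u, hu⟩ := hY g
    let c : WithConv (Y →ₗ[K] Y) :=
      toConv (LinearMap.toSpanSingleton K Y ((u⁻¹ : Yˣ) : Y) ∘ₗ counit)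
    have hcu : counit (R := K) (u : Y) = 1 := by rw [hu, g.2.counit_eq_one]
    have h₀ : (1 : WithConv (Y →ₗ[K] Y)).ofConv g.val = 1 := by simp
    have h₁ : (c * e).ofConv g.val = 1 := by
      rw [LinearMap.convMul_apply, g.2.comul_eq_tmul_self]
      simp [c, e, ← hu, hcu]
    have h₂ : (e * c).ofConv g.val = 1 := by
      rw [LinearMap.convMul_apply, g.2.comul_eq_tmul_self]
      simp [c, e, ← hu, hcu]
    refine ⟨L + (1 - L * e) * c, R + c * (1 - e * R), fun x hx => ⟨?_, ?_⟩⟩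
    · have hg : (1 - c * e).ofConv g.val = 0 := by
        rw [ofConv_sub, LinearMap.sub_apply, h₀, h₁, sub_self]
      have := (conv_eq_zero_of_mem_layer_cons (h := 1 - L * e) (fun x hx => (hLR x hx).1) hg hx).1
      rw [← this, show 1 - (L + (1 - L * e) * c) * e = (1 - L * e) * (1 - c * e) by noncomm_ring]
    · have hg : (1 - e * c).ofConv g.val = 0 := by
        rw [ofConv_sub, LinearMap.sub_apply, h₀, h₂, sub_self]
      have := (conv_eq_zero_of_mem_layer_cons (h := 1 - e * R) (fun x hx => (hLR x hx).2) hg hx).2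
      rw [← this, show 1 - e * (R + c * (1 - e * R)) = (1 - e * c) * (1 - e * R) by noncomm_ring]

/-- A cocommutative bialgebra over an algebraically closed field whose group-like elements are
invertible is a Hopf algebra. -/
theorem isHopfAlgebra_of_isUnit [IsAlgClosed K] (hY : ∀ g : GroupLike K Y, IsUnit g.val) :
    ∃ H : HopfAlgebra K Y, H.toBialgebra = ‹Bialgebra K Y› := by
  choose L R hLR using exists_conv_inverse_on_layer hY
  choose Z hZ using exists_mem_layer (K := K) (T := Y)
  let e : WithConv (Y →ₗ[K] Y) := toConv LinearMap.id
  -- On common layers, left and right inverses agree.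
  have hEq (Z₁ Z₂) (x : Y) (h₁ : x ∈ layer Z₁) (h₂ : x ∈ layer Z₂) : L Z₁ x = R Z₂ x := by
    have e₁ := (conv_eq_zero_of_mem_layer (k := R Z₂) (fun x hx => (hLR Z₁ x hx).1) h₁).1
    have e₂ := (conv_eq_zero_of_mem_layer (k := L Z₁) (fun x hx => (hLR Z₂ x hx).2) h₂).2
    have : R Z₂ - L Z₁ = (1 - L Z₁ * e) * R Z₂ - L Z₁ * (1 - e * R Z₂) := by noncomm_ring
    have h₃ : (R Z₂ - L Z₁).ofConv x = 0 := by
      rw [this]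
      change ((1 - L Z₁ * e) * R Z₂).ofConv x - (L Z₁ * (1 - e * R Z₂)).ofConv x = 0
      rw [e₁, e₂, sub_zero]
    exact (sub_eq_zero.mp h₃).symm
  have hL (Z₁) (x : Y) (h₁ : x ∈ layer Z₁) : L (Z x) x = L Z₁ x :=
    (hEq _ Z₁ x (hZ x) h₁).trans (hEq Z₁ Z₁ x h₁ h₁).symm
  let S : WithConv (Y →ₗ[K] Y) := toConv
    { toFun := fun x => L (Z x) x
      map_add' := fun x y => by
        have hx := layer_le_layer_add_right (Z x) (Z y) (hZ x)
        have hy := layer_le_layer_add_left (Z x) (Z y) (hZ y)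
        rw [hL _ _ hx, hL _ _ hy, hL _ _ (add_mem hx hy), map_add]
      map_smul' := fun r x => by
        rw [hL _ _ (Submodule.smul_mem _ r (hZ x)), map_smul, RingHom.id_apply] }
  refine ⟨HopfAlgebra.ofConvInverse S.ofConv (WithConv.ext (LinearMap.ext fun x => ?_))
    (WithConv.ext (LinearMap.ext fun x => ?_)), rfl⟩
  · have h := (conv_eq_zero_of_mem_layer (h := S - L (Z x)) (k := e)
      (fun y hy => sub_eq_zero.mpr (hL _ y hy)) (hZ x)).1
    have : S * e - 1 = (S - L (Z x)) * e - (1 - L (Z x) * e) := by noncomm_ring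
    refine sub_eq_zero.mp (?_ : (S * e - 1).ofConv x = 0)
    rw [this]
    change ((S - L (Z x)) * e).ofConv x - (1 - L (Z x) * e).ofConv x = 0
    rw [h, (hLR _ x (hZ x)).1, sub_zero]
  · have h := (conv_eq_zero_of_mem_layer (h := S - R (Z x)) (k := e)
      (fun y hy => sub_eq_zero.mpr (hEq _ _ y (hZ y) hy)) (hZ x)).2
    have : e * S - 1 = e * (S - R (Z x)) - (1 - e * R (Z x)) := by noncomm_ring
    refine sub_eq_zero.mp (?_ : (e * S - 1).ofConv x = 0)
    rw [this]
    change (e * (S - R (Z x))).ofConv x - (1 - e * R (Z x)).ofConv x = 0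
    rw [h, (hLR _ x (hZ x)).2, sub_zero]

end Antipode

/-! ### Group-like elements of tensor products, suprema of sub-bialgebras -/

section Auxiliary

variable {K A B : Type*} [Field K] [Ring A] [Bialgebra K A] [Ring B] [Bialgebra K B]

open CocommBialgCat in
/-- A group-like element of a tensor product is a pure tensor of group-like elements. -/
lemma IsGroupLikeElem.eq_tmul {d : A ⊗[K] B} (hd : IsGroupLikeElem K d) :
    projLeft (K := K) A B d ⊗ₜ[K] projRight (K := K) A B d = d := by
  have key (d : A ⊗[K] B) : TensorProduct.map (projLeft (K := K) A B : A ⊗[K] B →ₗ[K] A)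
      (projRight (K := K) A B : A ⊗[K] B →ₗ[K] B) (comul (R := K) d) = d := by
    induction d with
    | zero => simp
    | add z w hz hw => simp only [map_add, hz, hw]
    | tmul a b =>
      have h (z : A ⊗[K] A) (w : B ⊗[K] B) :
          TensorProduct.map (projLeft (K := K) A B : A ⊗[K] B →ₗ[K] A)
            (projRight (K := K) A B : A ⊗[K] B →ₗ[K] B)
            (TensorProduct.AlgebraTensorModule.tensorTensorTensorComm K K K K A A B B
              (z ⊗ₜ[K] w)) =
          TensorProduct.rid K A ((counit (R := K)).lTensor A z) ⊗ₜ[K]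
            TensorProduct.lid K B ((counit (R := K)).rTensor B w) := by
        induction z with
        | zero => simp
        | add z z' hz hz' => simp only [map_add, TensorProduct.add_tmul, hz, hz']
        | tmul a₁ a₂ =>
          induction w with
          | zero => simp
          | add w w' hw hw' => simp only [map_add, TensorProduct.tmul_add, hw, hw']
          | tmul b₁ b₂ => simp [TensorProduct.smul_tmul', smul_comm (counit (R := K) a₂)]
      rw [TensorProduct.comul_tmul]
      refine (h _ _).trans ?_
      simp
  have := key d
  rwa [hd.comul_eq_tmul_self] at this

namespace SubBialgebra

lemma range_map_val_mono {S S' : Subalgebra K A} (h : S ≤ S') :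
    (Algebra.TensorProduct.map S.val S.val).range ≤
      (Algebra.TensorProduct.map S'.val S'.val).range := by
  rintro _ ⟨z, rfl⟩
  refine ⟨Algebra.TensorProduct.map (Subalgebra.inclusion h) (Subalgebra.inclusion h) z, ?_⟩
  have : (Algebra.TensorProduct.map S'.val S'.val).comp (Algebra.TensorProduct.map
      (Subalgebra.inclusion h) (Subalgebra.inclusion h)) =
      Algebra.TensorProduct.map S.val S.val := by
    ext <;> simp
  exact AlgHom.congr_fun this z

/-- The image of a bialgebra morphism. -/
noncomputable def range (f : B →ₐc[K] A) : SubBialgebra K A where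
  toSubalgebra := (f : B →ₐ[K] A).range
  comul_mem' := by
    rintro _ ⟨b, rfl⟩
    refine ⟨Algebra.TensorProduct.map (f : B →ₐ[K] A).rangeRestrict (f : B →ₐ[K] A).rangeRestrict
      (comul (R := K) b), ?_⟩
    have : (Algebra.TensorProduct.map (f : B →ₐ[K] A).range.val (f : B →ₐ[K] A).range.val).comp
        (Algebra.TensorProduct.map (f : B →ₐ[K] A).rangeRestrict
          (f : B →ₐ[K] A).rangeRestrict) =
        Algebra.TensorProduct.map (f : B →ₐ[K] A) (f : B →ₐ[K] A) := by
      ext <;> simp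
    exact (AlgHom.congr_fun this _).trans (CoalgHomClass.map_comp_comul_apply f b)

/-- The sub-bialgebra generated by two sub-bialgebras: the subalgebra that they generate. -/
noncomputable def sup (S S' : SubBialgebra K A) : SubBialgebra K A where
  toSubalgebra := S.toSubalgebra ⊔ S'.toSubalgebra
  comul_mem' := by
    refine (sup_le (fun x hx => ?_) (fun x hx => ?_) : S.toSubalgebra ⊔ S'.toSubalgebra ≤
      (Algebra.TensorProduct.map (S.toSubalgebra ⊔ S'.toSubalgebra).val
        (S.toSubalgebra ⊔ S'.toSubalgebra).val).range.comap (Bialgebra.comulAlgHom K A))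
    · exact range_map_val_mono le_sup_left (S.comul_mem' x hx)
    · exact range_map_val_mono le_sup_right (S'.comul_mem' x hx)

end SubBialgebra

namespace CocommBialgCat

variable {K : Type u} [Field K] {X Y : Type u} [Ring X] [Bialgebra K X] [IsCocomm K X] [Ring Y]
  [Bialgebra K Y] [IsCocomm K Y]

/-- The split extension given by a split epimorphism of cocommutative bialgebras; its kernel is
the equalizer with the zero morphism. -/
noncomputable def splitExtension (f : X →ₐc[K] Y) (s : Y →ₐc[K] X) (h : f.comp s = .id K Y) :
    SplitExtension (of K Y) where
  ker := of K (SubBialgebra.equalizer f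
    ((Bialgebra.unitBialgHom K Y).comp (Bialgebra.counitBialgHom K X))).Carrier
  mid := of K X
  k := ofHom (SubBialgebra.incl _)
  f := ofHom f
  s := ofHom s
  section_comp := toBialgHom_injective h
  kernel_comp := toBialgHom_injective <| BialgHom.ext fun x =>
    SubBialgebra.eq_of_mem_equalizer (u := f)
      (v := (Bialgebra.unitBialgHom K Y).comp (Bialgebra.counitBialgHom K X)) x.2
  isKernel := Fork.IsLimit.mk _
    (fun c => ofHom ((SubBialgebra.equalizer f
      ((Bialgebra.unitBialgHom K Y).comp (Bialgebra.counitBialgHom K X))).codRestrict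
      (toBialgHom (Fork.ι c)) (SubBialgebra.mem_equalizer_of_comp_eq _ fun t =>
        CoalgHom.congr_fun (congrArg toCoalgHom c.condition) t)))
    (fun _ => toBialgHom_injective (BialgHom.ext fun _ => rfl))
    (fun _ _ hm => toBialgHom_injective (BialgHom.ext fun x => Subtype.ext
      (BialgHom.congr_fun (congrArg toBialgHom hm) x)))

/-- If a split extension is strong, then its middle object is generated, as an algebra, by the
kernel and the image of the section. -/
lemma sup_eq_top_of_isStrong (f : X →ₐc[K] Y) (s : Y →ₐc[K] X) (h : f.comp s = .id K Y)
    (hE : (splitExtension f s h).IsStrong) :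
    (SubBialgebra.equalizer f ((Bialgebra.unitBialgHom K Y).comp
      (Bialgebra.counitBialgHom K X))).toSubalgebra ⊔ (s : Y →ₐ[K] X).range = ⊤ := by
  set A := SubBialgebra.equalizer f
    ((Bialgebra.unitBialgHom K Y).comp (Bialgebra.counitBialgHom K X))
  let M := A.sup (SubBialgebra.range s)
  let m : of K M.Carrier ⟶ of K X := ofHom M.incl
  have : Mono m := ⟨fun _ _ hab => toBialgHom_injective (BialgHom.ext fun x => Subtype.ext
    (BialgHom.congr_fun (congrArg toBialgHom hab) x))⟩
  have hA (x : A.Carrier) : A.incl x ∈ M.toSubalgebra :=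
    (le_sup_left : A.toSubalgebra ≤ A.toSubalgebra ⊔ (s : Y →ₐ[K] X).range) x.2
  have hs (y : Y) : s y ∈ M.toSubalgebra :=
    (le_sup_right : (s : Y →ₐ[K] X).range ≤ A.toSubalgebra ⊔ (s : Y →ₐ[K] X).range) ⟨y, rfl⟩
  have hm : IsIso m := @hE _ m this (ofHom (M.codRestrict A.incl hA)) (ofHom (M.codRestrict s hs))
    (toBialgHom_injective (BialgHom.ext fun _ => rfl))
    (toBialgHom_injective (BialgHom.ext fun _ => rfl))
  rw [eq_top_iff]
  intro x _
  have hx : M.incl (toBialgHom (inv m) x) = x :=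
    BialgHom.congr_fun (congrArg toBialgHom (IsIso.inv_hom_id m)) x
  rw [← hx]
  exact (toBialgHom (inv m) x).2

end CocommBialgCat

end Auxiliary

/-! ### A split extension that detects invertibility of a group-like element -/

section InsertionExtension

variable {K Y : Type*} [Field K] [Ring Y] [Bialgebra K Y]

namespace GroupLike

/-- The coalgebra morphism `Y ⊗ Y → Y`, `a ⊗ b ↦ a g b`. -/
noncomputable def insert (g : GroupLike K Y) : Y ⊗[K] Y →ₗc[K] Y :=
  (Bialgebra.mulCoalgHom K Y).comp (Coalgebra.TensorProduct.map
    { toLinearMap := LinearMap.mulRight K g.val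
      counit_comp := by ext; simp
      map_comp_comul := by
        ext a
        simp only [LinearMap.comp_apply, LinearMap.mulRight_apply, Bialgebra.comul_mul,
          g.2.comul_eq_tmul_self]
        induction comul (R := K) a with
        | zero => simp
        | add z w hz hw => simp only [map_add, add_mul, hz, hw]
        | tmul b c => simp }
    (CoalgHom.id K Y))

@[simp] lemma insert_tmul (g : GroupLike K Y) (a b : Y) :
    g.insert (a ⊗ₜ b) = a * g.val * b := rfl

/-- The bialgebra morphism `a ↦ a ⊗ 1`. -/
noncomputable def inclLeft (K Y : Type*) [Field K] [Ring Y] [Bialgebra K Y] :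
    Y →ₐc[K] Y ⊗[K] Y :=
  (Bialgebra.TensorProduct.map (.id K Y) (Bialgebra.unitBialgHom K Y)).comp
    ((Bialgebra.TensorProduct.rid K K Y).symm : Y →ₐc[K] Y ⊗[K] K)

/-- The bialgebra morphism `a ↦ 1 ⊗ a`. -/
noncomputable def inclRight (K Y : Type*) [Field K] [Ring Y] [Bialgebra K Y] :
    Y →ₐc[K] Y ⊗[K] Y :=
  (Bialgebra.TensorProduct.map (Bialgebra.unitBialgHom K Y) (.id K Y)).comp
    ((Bialgebra.TensorProduct.lid K Y).symm : Y →ₐc[K] K ⊗[K] Y)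

lemma inclLeft_apply (a : Y) : inclLeft K Y a = a ⊗ₜ[K] 1 :=
  congrArg (a ⊗ₜ[K] ·) (map_one (algebraMap K Y))

lemma inclRight_apply (a : Y) : inclRight K Y a = (1 : Y) ⊗ₜ[K] a :=
  congrArg (· ⊗ₜ[K] a) (map_one (algebraMap K Y))

lemma insert_inclLeft_mul (g : GroupLike K Y) (a : Y) (s : Y ⊗[K] Y) :
    g.insert (inclLeft K Y a * s) = a * g.insert s := by
  rw [inclLeft_apply]
  induction s with
  | zero => simp
  | add z w hz hw => simp only [map_add, mul_add, hz, hw]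
  | tmul b c => simp [mul_assoc]

lemma insert_mul_inclRight (g : GroupLike K Y) (s : Y ⊗[K] Y) (b : Y) :
    g.insert (s * inclRight K Y b) = g.insert s * b := by
  rw [inclRight_apply]
  induction s with
  | zero => simp
  | add z w hz hw => simp only [map_add, add_mul, hz, hw]
  | tmul b c => simp [mul_assoc]

/-- The middle object of a split extension of `Y` built from a group-like element `g`: the coalgebra
`Y ⊕ (Y ⊗ Y)`, whose elements `(y, a ⊗ b)` stand for `y + a t b` with a formal symbol `t` lying
over `g`. Its multiplication is given by the rule `t c t = t c g`. -/
def Insertion (_ : GroupLike K Y) : Type _ := Y × (Y ⊗[K] Y)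

namespace Insertion

variable (g : GroupLike K Y)

noncomputable instance : AddCommGroup g.Insertion := inferInstanceAs (AddCommGroup (Y × (Y ⊗[K] Y)))
noncomputable instance : Module K g.Insertion := inferInstanceAs (Module K (Y × (Y ⊗[K] Y)))
noncomputable instance : Coalgebra K g.Insertion :=
  inferInstanceAs (Coalgebra K (Y × (Y ⊗[K] Y)))
instance [IsCocomm K Y] : IsCocomm K g.Insertion := inferInstanceAs (IsCocomm K (Y × (Y ⊗[K] Y)))

/-- The summand `Y` of `Y ⊕ (Y ⊗ Y)`. -/
noncomputable def inl : Y →ₗ[K] g.Insertion := LinearMap.inl K Y (Y ⊗[K] Y)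

/-- The summand `Y ⊗ Y` of `Y ⊕ (Y ⊗ Y)`. -/
noncomputable def inr : Y ⊗[K] Y →ₗ[K] g.Insertion := LinearMap.inr K Y (Y ⊗[K] Y)

/-- The projection to the summand `Y` of `Y ⊕ (Y ⊗ Y)`. -/
noncomputable def fst : g.Insertion →ₗ[K] Y := LinearMap.fst K Y (Y ⊗[K] Y)

/-- The projection to the summand `Y ⊗ Y` of `Y ⊕ (Y ⊗ Y)`. -/
noncomputable def snd : g.Insertion →ₗ[K] Y ⊗[K] Y := LinearMap.snd K Y (Y ⊗[K] Y)

variable {g}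

@[ext] lemma ext {x y : g.Insertion} (h₁ : fst g x = fst g y) (h₂ : snd g x = snd g y) : x = y :=
  Prod.ext h₁ h₂

@[simp] lemma fst_inl (a : Y) : fst g (inl g a) = a := rfl
@[simp] lemma snd_inl (a : Y) : snd g (inl g a) = 0 := rfl
@[simp] lemma fst_inr (s : Y ⊗[K] Y) : fst g (inr g s) = 0 := rfl
@[simp] lemma snd_inr (s : Y ⊗[K] Y) : snd g (inr g s) = s := rfl

lemma inl_add_inr (x : g.Insertion) : inl g (fst g x) + inr g (snd g x) = x := by
  ext <;> simp

lemma comul_inl (a : Y) :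
    comul (R := K) (inl g a) = TensorProduct.map (inl g) (inl g) (comul (R := K) a) :=
  LinearMap.congr_fun (Prod.comul_comp_inl K Y (Y ⊗[K] Y)) a

lemma comul_inr (s : Y ⊗[K] Y) :
    comul (R := K) (inr g s) = TensorProduct.map (inr g) (inr g) (comul (R := K) s) :=
  LinearMap.congr_fun (Prod.comul_comp_inr K Y (Y ⊗[K] Y)) s

@[simp] lemma counit_inl (a : Y) : counit (R := K) (inl g a) = counit (R := K) a :=
  LinearMap.congr_fun (Prod.counit_comp_inl K Y (Y ⊗[K] Y)) a

@[simp] lemma counit_inr (s : Y ⊗[K] Y) : counit (R := K) (inr g s) = counit (R := K) s :=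
  LinearMap.congr_fun (Prod.counit_comp_inr K Y (Y ⊗[K] Y)) s

noncomputable instance : Mul g.Insertion where
  mul x y := inl g (fst g x * fst g y) + inr g (inclLeft K Y (fst g x) * snd g y +
    snd g x * inclRight K Y (fst g y + g.insert (snd g y)))

noncomputable instance : One g.Insertion := ⟨inl g 1⟩

lemma one_def : (1 : g.Insertion) = inl g 1 := rfl

@[simp] lemma fst_one : fst g 1 = 1 := rfl

@[simp] lemma snd_one : snd g 1 = 0 := rfl

@[simp] lemma fst_mul (x y : g.Insertion) : fst g (x * y) = fst g x * fst g y :=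
  add_zero _

@[simp] lemma snd_mul (x y : g.Insertion) : snd g (x * y) = inclLeft K Y (fst g x) * snd g y +
    snd g x * inclRight K Y (fst g y + g.insert (snd g y)) :=
  zero_add _

noncomputable instance : Ring g.Insertion where
  __ := (inferInstance : AddCommGroup g.Insertion)
  mul_assoc x y z := by
    ext
    · simp [mul_assoc]
    · simp only [fst_mul, snd_mul, map_mul, mul_add, map_add, insert_inclLeft_mul,
        insert_mul_inclRight]
      noncomm_ring
  one_mul x := by ext <;> simp
  mul_one x := by ext <;> simp
  left_distrib x y z := by
    ext
    · simp [mul_add]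
    · simp only [snd_mul, map_add]
      noncomm_ring
  right_distrib x y z := by
    ext
    · simp [add_mul]
    · simp only [snd_mul, map_add]
      noncomm_ring
  zero_mul x := by ext <;> simp
  mul_zero x := by ext <;> simp

noncomputable instance : Algebra K g.Insertion :=
  .ofModule
    (fun r x y => by ext <;> simp [mul_add, smul_add])
    (fun r x y => by ext <;> simp [mul_add, smul_add])

lemma inl_mul_inl (a b : Y) : inl g a * inl g b = inl g (a * b) := by ext <;> simp

lemma inl_mul_inr (a : Y) (s : Y ⊗[K] Y) : inl g a * inr g s = inr g (inclLeft K Y a * s) := by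
  ext <;> simp

lemma inr_mul_inl (s : Y ⊗[K] Y) (a : Y) : inr g s * inl g a = inr g (s * inclRight K Y a) := by
  ext <;> simp

lemma inr_mul_inr (s t : Y ⊗[K] Y) :
    inr g s * inr g t = inr g (s * inclRight K Y (g.insert t)) := by
  ext <;> simp

/-- Multiplicativity of the comultiplication on a pair of summands `u` and `v`, given that the
product of two such elements is computed in the bialgebra `B`, after coalgebra morphisms `p`
and `q`. -/
lemma comul_mul_of_eq {P Q B : Type*} [AddCommGroup P] [Module K P] [Coalgebra K P]
    [AddCommGroup Q] [Module K Q] [Coalgebra K Q] [Ring B] [Bialgebra K B]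
    {u : P →ₗ[K] g.Insertion} {v : Q →ₗ[K] g.Insertion} {w : B →ₗ[K] g.Insertion}
    (p : P →ₗc[K] B) (q : Q →ₗc[K] B) (h : ∀ c d, u c * v d = w (p c * q d))
    (hu : ∀ c, comul (R := K) (u c) = TensorProduct.map u u (comul (R := K) c))
    (hv : ∀ c, comul (R := K) (v c) = TensorProduct.map v v (comul (R := K) c))
    (hw : ∀ c, comul (R := K) (w c) = TensorProduct.map w w (comul (R := K) c)) (c : P) (d : Q) :
    comul (R := K) (u c * v d) = comul (R := K) (u c) * comul (R := K) (v d) := by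
  have key (z : P ⊗[K] P) (z' : Q ⊗[K] Q) :
      TensorProduct.map u u z * TensorProduct.map v v z' = TensorProduct.map w w
        (TensorProduct.map (p : P →ₗ[K] B) (p : P →ₗ[K] B) z *
          TensorProduct.map (q : Q →ₗ[K] B) (q : Q →ₗ[K] B) z') := by
    induction z with
    | zero => simp
    | add z w hz hw => simp only [map_add, add_mul, hz, hw]
    | tmul a b =>
      induction z' with
      | zero => simp
      | add z w hz hw => simp only [map_add, mul_add, hz, hw]
      | tmul a' b' => simp [h]
  rw [hu, hv, key, h, hw, Bialgebra.comul_mul]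
  congr 2
  · exact (CoalgHomClass.map_comp_comul_apply p c).symm
  · exact (CoalgHomClass.map_comp_comul_apply q d).symm

noncomputable instance : Bialgebra K g.Insertion :=
  Bialgebra.mk' K g.Insertion (by simp [one_def])
    (by
      intro x y
      rw [← inl_add_inr x, ← inl_add_inr y]
      simp only [add_mul, mul_add, inl_mul_inl, inl_mul_inr, inr_mul_inl, inr_mul_inr, map_add,
        counit_inl, counit_inr, Bialgebra.counit_mul, CoalgHomClass.counit_comp_apply])
    (by simp [one_def, comul_inl, Algebra.TensorProduct.one_def])
    (by
      intro x y
      rw [← inl_add_inr x, ← inl_add_inr y]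
      simp only [add_mul, mul_add, map_add]
      rw [comul_mul_of_eq (CoalgHom.id K Y) (CoalgHom.id K Y) inl_mul_inl
          comul_inl comul_inl comul_inl,
        comul_mul_of_eq (inclLeft K Y : Y →ₗc[K] Y ⊗[K] Y) (CoalgHom.id K (Y ⊗[K] Y)) inl_mul_inr
          comul_inl comul_inr comul_inr,
        comul_mul_of_eq (CoalgHom.id K (Y ⊗[K] Y)) (inclRight K Y : Y →ₗc[K] Y ⊗[K] Y) inr_mul_inl
          comul_inr comul_inl comul_inr,
        comul_mul_of_eq (CoalgHom.id K (Y ⊗[K] Y))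
          ((inclRight K Y : Y →ₗc[K] Y ⊗[K] Y).comp g.insert) inr_mul_inr
          comul_inr comul_inr comul_inr])

variable (g)

/-- The section `Y → Y ⊕ (Y ⊗ Y)`. -/
noncomputable def sec : Y →ₐc[K] g.Insertion :=
  .ofAlgHom (.ofLinearMap (inl g) rfl fun a b => (inl_mul_inl a b).symm)
    (AlgHom.ext (counit_inl (g := g))) (AlgHom.ext fun a => (comul_inl a).symm)

/-- The split epimorphism `Y ⊕ (Y ⊗ Y) → Y`, which sends `t` to `g`. -/
noncomputable def proj : g.Insertion →ₐc[K] Y :=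
  .ofAlgHom (.ofLinearMap (fst g + g.insert.toLinearMap ∘ₗ snd g) (by simp) (by
      intro x y
      simp [mul_add, insert_inclLeft_mul, insert_mul_inclRight]
      noncomm_ring))
    (AlgHom.ext fun x => by
      change counit (R := K) (fst g x + g.insert (snd g x)) = counit (R := K) x
      rw [← inl_add_inr x]
      simp)
    (AlgHom.ext fun x => by
      have hl : (fst g + g.insert.toLinearMap ∘ₗ snd g) ∘ₗ inl g = LinearMap.id := by
        ext; simp
      have hr : (fst g + g.insert.toLinearMap ∘ₗ snd g) ∘ₗ inr g = g.insert.toLinearMap := by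
        ext; simp
      change TensorProduct.map (fst g + g.insert.toLinearMap ∘ₗ snd g)
        (fst g + g.insert.toLinearMap ∘ₗ snd g) (comul (R := K) x) =
          comul (R := K) (fst g x + g.insert (snd g x))
      conv_lhs => rw [← inl_add_inr x]
      rw [map_add, comul_inl, comul_inr, map_add, map_add, TensorProduct.map_map,
        TensorProduct.map_map, hl, hr, TensorProduct.map_id]
      exact congrArg (_ + ·) (CoalgHomClass.map_comp_comul_apply g.insert _))

variable {g}

@[simp] lemma proj_inl (a : Y) : proj g (inl g a) = a := by
  change a + g.insert 0 = a
  simp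

@[simp] lemma proj_inr (s : Y ⊗[K] Y) : proj g (inr g s) = g.insert s := zero_add _

lemma proj_comp_sec : (proj g).comp (sec g) = .id K Y := BialgHom.ext proj_inl

end Insertion

end GroupLike

end InsertionExtension

/-! ### Strongness of the extension forces invertibility -/

section Invertibility

namespace GroupLike.Insertion

variable {K Y : Type*} [Field K] [Ring Y] [Bialgebra K Y] {g : GroupLike K Y}

lemma isGroupLikeElem_of_inr {s : Y ⊗[K] Y} (hs : IsGroupLikeElem K (inr g s)) :
    IsGroupLikeElem K s where
  counit_eq_one := (counit_inr s).symm.trans hs.counit_eq_one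
  comul_eq_tmul_self := by
    have h : TensorProduct.map (snd g) (snd g) (comul (R := K) (inr g s)) = s ⊗ₜ s := by
      rw [hs.comul_eq_tmul_self]; simp
    have hsnd : snd g ∘ₗ inr g = LinearMap.id := rfl
    rw [← h, comul_inr, TensorProduct.map_map, hsnd, TensorProduct.map_id]
    rfl

lemma isGroupLikeElem_inr {s : Y ⊗[K] Y} (hs : IsGroupLikeElem K s) :
    IsGroupLikeElem K (inr g s) where
  counit_eq_one := (counit_inr s).trans hs.counit_eq_one
  comul_eq_tmul_self := by rw [comul_inr, hs.comul_eq_tmul_self]; rfl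

variable [IsCocomm K Y]

variable (g) in
/-- The kernel of the split epimorphism `Y ⊕ (Y ⊗ Y) → Y`. -/
noncomputable abbrev kernel : SubBialgebra K g.Insertion :=
  SubBialgebra.equalizer (proj g)
    ((Bialgebra.unitBialgHom K Y).comp (Bialgebra.counitBialgHom K g.Insertion))

lemma proj_of_mem_kernel {x : g.Insertion} (hx : x ∈ (kernel g).toSubalgebra) :
    proj g x = algebraMap K Y (counit x) :=
  SubBialgebra.eq_of_mem_equalizer hx

/-- The split epimorphism is injective on the summand `Y`, which therefore meets its kernel in
scalars only. -/
lemma fst_of_mem_kernel {x : g.Insertion} (hx : x ∈ (kernel g).toSubalgebra) :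
    fst g x = algebraMap K Y (counit (fst g x)) := by
  have hl : TensorProduct.map (fst g) (proj g : g.Insertion →ₗ[K] Y) (comul (R := K) x) =
      comul (R := K) (fst g x) := by
    have h₁ : (proj g : g.Insertion →ₗ[K] Y) ∘ₗ inl g = LinearMap.id := LinearMap.ext proj_inl
    have h₂ : fst g ∘ₗ inl g = LinearMap.id := rfl
    have h₃ : fst g ∘ₗ inr g = 0 := rfl
    conv_lhs => rw [← inl_add_inr x]
    rw [map_add, comul_inl, comul_inr, map_add, TensorProduct.map_map, TensorProduct.map_map,
      h₁, h₂, h₃, TensorProduct.map_zero_left, TensorProduct.map_id, LinearMap.zero_apply,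
      add_zero, LinearMap.id_apply]
  have hr (z : g.Insertion ⊗[K] g.Insertion) : TensorProduct.map (fst g)
      (((Bialgebra.unitBialgHom K Y).comp (Bialgebra.counitBialgHom K g.Insertion) :
        g.Insertion →ₐc[K] Y) : g.Insertion →ₗ[K] Y) z =
      fst g (TensorProduct.rid K _ ((counit (R := K)).lTensor _ z)) ⊗ₜ 1 := by
    induction z with
    | zero => simp
    | add z w hz hw => simp only [map_add, TensorProduct.add_tmul, hz, hw]
    | tmul a b =>
      have hb : Bialgebra.unitBialgHom K Y (counit b) = counit (R := K) b • 1 :=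
        Algebra.algebraMap_eq_smul_one _
      simp [hb, TensorProduct.smul_tmul']
  -- Applying `fst` to the left leg of `x₁ ⊗ proj x₂ = x₁ ⊗ ε(x₂)`.
  have h := congrArg ((fst g).rTensor Y) (SubBialgebra.mem_equalizer.mp hx)
  simp only [LinearMap.rTensor, LinearMap.lTensor, TensorProduct.map_map, LinearMap.comp_id,
    LinearMap.id_comp] at h
  rw [hl, hr, lTensor_counit_comul, TensorProduct.rid_tmul,
    one_smul] at h
  have h' := congrArg (fun z => TensorProduct.lid K Y ((counit (R := K)).rTensor Y z)) h
  simpa [Algebra.algebraMap_eq_smul_one] using h'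

variable (g) in
/-- The coalgebra morphism `y ⊗ α ⊗ z ↦ y α z`, with `α` in the kernel and `y`, `z` in the image of
the section. -/
noncomputable def sandwich : (Y ⊗[K] (kernel g).Carrier) ⊗[K] Y →ₗc[K] g.Insertion :=
  (Bialgebra.mulCoalgHom K g.Insertion).comp (Coalgebra.TensorProduct.map
    ((Bialgebra.mulCoalgHom K g.Insertion).comp (Coalgebra.TensorProduct.map
      (sec g : Y →ₗc[K] g.Insertion) ((kernel g).incl : (kernel g).Carrier →ₗc[K] g.Insertion)))
    (sec g : Y →ₗc[K] g.Insertion))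

@[simp] lemma sandwich_tmul (y z : Y) (α : (kernel g).Carrier) :
    sandwich g (y ⊗ₜ α ⊗ₜ z) = inl g y * α * inl g z := rfl

/-- If the kernel and the image of the section generate the middle object, then `t` is a
combination of products `y α z`, with `α` in the kernel. -/
lemma exists_sandwich_eq (h : (kernel g).toSubalgebra ⊔ (sec g : Y →ₐ[K] g.Insertion).range = ⊤)
    (s : Y ⊗[K] Y) : ∃ w, sandwich g w = inr g s := by
  have hl (y : Y) (w) : ∃ w', sandwich g w' = inl g y * sandwich g w := by
    refine ⟨((LinearMap.mulLeft K y).rTensor _).rTensor _ w, LinearMap.congr_fun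
      (f := (sandwich g : _ →ₗ[K] g.Insertion) ∘ₗ ((LinearMap.mulLeft K y).rTensor _).rTensor _)
      (g := LinearMap.mulLeft K (inl g y) ∘ₗ (sandwich g : _ →ₗ[K] g.Insertion))
      (TensorProduct.ext_threefold fun a α b => ?_) w⟩
    simp [← inl_mul_inl, mul_assoc]
  have hr (z : Y) (w) : ∃ w', sandwich g w' = sandwich g w * inl g z := by
    refine ⟨(LinearMap.mulRight K z).lTensor _ w, LinearMap.congr_fun
      (f := (sandwich g : _ →ₗ[K] g.Insertion) ∘ₗ (LinearMap.mulRight K z).lTensor _)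
      (g := LinearMap.mulRight K (inl g z) ∘ₗ (sandwich g : _ →ₗ[K] g.Insertion))
      (TensorProduct.ext_threefold fun a α b => ?_) w⟩
    simp [← inl_mul_inl, mul_assoc]
  -- The elements whose component in `Y ⊗ Y` is a value of `sandwich` form a subalgebra.
  let N : Subalgebra K g.Insertion :=
    { carrier := {x | ∃ w, sandwich g w = inr g (snd g x)}
      mul_mem' := by
        rintro x x' ⟨w, hw⟩ ⟨w', hw'⟩
        obtain ⟨v, hv⟩ := hl (fst g x) w'
        obtain ⟨v', hv'⟩ := hr (fst g x' + g.insert (snd g x')) w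
        exact ⟨v + v', by
          rw [map_add, hv, hv', hw, hw', inl_mul_inr, inr_mul_inl, snd_mul]
          exact (map_add _ _ _).symm⟩
      add_mem' := by
        rintro x x' ⟨w, hw⟩ ⟨w', hw'⟩
        exact ⟨w + w', by rw [map_add, hw, hw', map_add, map_add]⟩
      algebraMap_mem' := fun r => ⟨0, by simp [Algebra.algebraMap_eq_smul_one]⟩ }
  have hN : (kernel g).toSubalgebra ⊔ (sec g : Y →ₐ[K] g.Insertion).range ≤ N := by
    refine sup_le (fun x hx => ?_) ?_
    · -- Subtracting a scalar from `x` removes its component in `Y`.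
      have hα : x - algebraMap K _ (counit (fst g x)) ∈ (kernel g).toSubalgebra :=
        sub_mem hx (Subalgebra.algebraMap_mem _ _)
      refine ⟨1 ⊗ₜ ⟨_, hα⟩ ⊗ₜ 1, ?_⟩
      have hx' := fst_of_mem_kernel hx
      rw [sandwich_tmul, ← one_def, one_mul, mul_one]
      ext
      · simp only [map_sub, fst_inr]
        rw [sub_eq_zero, hx']
        simp [Algebra.algebraMap_eq_smul_one]
      · simp [Algebra.algebraMap_eq_smul_one]
    · rintro _ ⟨y, rfl⟩
      exact ⟨0, by change _ = inr g (snd g (inl g y)); simp⟩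
  rw [h] at hN
  exact hN (Algebra.mem_top (x := inr g s))

/-- If the split extension attached to `g` is generated by its kernel and its section, then `g` is
invertible: lifting the group-like element `t` along `sandwich` gives group-like elements with
`t = y (a t b) z` and `a g b = 1`, so that `y a = 1` and `b z = 1`. -/
lemma isUnit_of_sup_eq_top [IsAlgClosed K]
    (h : (kernel g).toSubalgebra ⊔ (sec g : Y →ₐ[K] g.Insertion).range = ⊤) : IsUnit g.val := by
  obtain ⟨w, hw⟩ := exists_sandwich_eq h 1
  obtain ⟨d, hd, hdw⟩ := DualAlgebra.exists_isGroupLikeElem_map_eq (sandwich g) w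
    (hw ▸ isGroupLikeElem_inr .one)
  rw [hw] at hdw
  have hd₁ := hd.map (CocommBialgCat.projLeft (K := K) (Y ⊗[K] (kernel g).Carrier) Y)
  have hz := hd.map (CocommBialgCat.projRight (K := K) (Y ⊗[K] (kernel g).Carrier) Y)
  have hy := hd₁.map (CocommBialgCat.projLeft (K := K) Y (kernel g).Carrier)
  have hα := hd₁.map (CocommBialgCat.projRight (K := K) Y (kernel g).Carrier)
  rw [← hd.eq_tmul, ← hd₁.eq_tmul, sandwich_tmul] at hdw
  generalize CocommBialgCat.projRight (K := K) (Y ⊗[K] (kernel g).Carrier) Y d = z at *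
  generalize CocommBialgCat.projLeft (K := K) (Y ⊗[K] (kernel g).Carrier) Y d = d₁ at *
  generalize CocommBialgCat.projLeft (K := K) Y (kernel g).Carrier d₁ = y at *
  generalize CocommBialgCat.projRight (K := K) Y (kernel g).Carrier d₁ = α at *
  replace hα := hα.map (kernel g).incl
  rw [SubBialgebra.incl_apply] at hα
  have hfst := fst_of_mem_kernel α.2
  have hproj := proj_of_mem_kernel α.2
  rw [hα.counit_eq_one, map_one] at hproj
  -- The component of `α` in `Y` is a scalar, which vanishes because `y α z = t` has none.
  have hα₀ : fst g (α : g.Insertion) = 0 := by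
    have h₀ := congrArg (fun x => counit (R := K) (fst g x)) hdw
    simp only [fst_mul, fst_inl, fst_inr, Bialgebra.counit_mul, hy.counit_eq_one,
      hz.counit_eq_one, map_zero, one_mul, mul_one] at h₀
    rw [hfst, h₀, map_zero]
  have hs : inr g (snd g (α : g.Insertion)) = α := by
    conv_rhs => rw [← inl_add_inr (α : g.Insertion), hα₀, map_zero, zero_add]
  rw [← hs] at hα hdw hproj
  replace hα := isGroupLikeElem_of_inr hα
  generalize snd g (α : g.Insertion) = s at *
  have ha := hα.map (CocommBialgCat.projLeft (K := K) Y Y)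
  have hb := hα.map (CocommBialgCat.projRight (K := K) Y Y)
  rw [inl_mul_inr, inr_mul_inl] at hdw
  replace hdw := congrArg (snd g) hdw
  rw [← hα.eq_tmul] at hdw hproj
  generalize CocommBialgCat.projLeft (K := K) Y Y s = a at *
  generalize CocommBialgCat.projRight (K := K) Y Y s = b at *
  rw [proj_inr, insert_tmul] at hproj
  simp only [snd_inr, inclLeft_apply, inclRight_apply, Algebra.TensorProduct.tmul_mul_tmul,
    one_mul, mul_one] at hdw
  have hya : y * a = 1 := by
    simpa [hb.counit_eq_one, hz.counit_eq_one, Algebra.TensorProduct.one_def] using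
      congrArg (CocommBialgCat.projLeft (K := K) Y Y) hdw
  have hbz : b * z = 1 := by
    simpa [ha.counit_eq_one, hy.counit_eq_one, Algebra.TensorProduct.one_def] using
      congrArg (CocommBialgCat.projRight (K := K) Y Y) hdw
  refine ⟨⟨g.val, b * a, ?_, ?_⟩, rfl⟩
  · calc g.val * (b * a) = (y * a) * (g.val * (b * a)) := by rw [hya, one_mul]
      _ = y * (a * g.val * b) * a := by simp only [mul_assoc]
      _ = 1 := by rw [hproj, mul_one, hya]
  · calc b * a * g.val = b * a * g.val * (b * z) := by rw [hbz, mul_one]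
      _ = b * (a * g.val * b) * z := by simp only [mul_assoc]
      _ = 1 := by rw [hproj, mul_one, hbz]

end GroupLike.Insertion

end Invertibility

theorem theorem2 (K : Type u) [Field K] [IsAlgClosed K]
    (Y : Type u) [Ring Y] [Bialgebra K Y] [Coalgebra.IsCocomm K Y] :
    List.TFAE [
      IsHopfAlgebra K Y,
      ∀ E : SplitExtension (CocommBialgCat.of K Y), E.IsStrong,
      IsProtomodularObject (CocommBialgCat.of K Y)] := by
  tfae_have 1 → 3 := CocommBialgCat.isProtomodularObject_of_isHopfAlgebra Y
  tfae_have 3 → 2 := fun h E => h.isStrong E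
  tfae_have 2 → 1 := fun h => isHopfAlgebra_of_isUnit fun g =>
    GroupLike.Insertion.isUnit_of_sup_eq_top (CocommBialgCat.sup_eq_top_of_isStrong _ _
      GroupLike.Insertion.proj_comp_sec (h (CocommBialgCat.splitExtension _ _ _)))
  tfae_finish
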